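/- Fix integers $d\ge 2$ and $d_{\hat A}\ge 2$ and a real number $p\in[0,1]$. Let $\mathcal S^d_{AB}(\omega)=F\omega F^\dagger$ be the unitary swap channel on two $d$-dimensional systems $A,B$, where $F=\sum_{i,j}|i\rangle\langle j|\otimes|j\rangle\langle i|$, and let $$W^{(p,d_{\hat A})}_{\hat A\hat B}=(1-p)\,\frac{2}{d_{\hat A}(d_{\hat A}+1)}\,\frac{I+F}{2}+p\,\frac{2}{d_{\hat A}(d_{\hat A}-1)}\,\frac{I-F}{2}$$ be the Werner state on two $d_{\hat A}$-dimensional systems $\hat A,\hat B$ (here $F$ is the swap operator of $\hat A\hat B$). For a state $\rho_{\hat A\hat B}$ let $$e_{\mathrm{LOCC}}(\mathcal S^d_{AB},\rho_{\hat A\hat B})=\inf_{\mathcal L}\tfrac12\big\|\mathcal S^d_{AB}-\mathcal L_{AB\hat A\hat B\to AB}(\,\cdot\,\otimes\rho_{\hat A\hat B})\big\|_\diamond ,$$ where the infimum is over all channels $\mathcal L$ that can be implemented by finitely many rounds of local operations and classical communication between Alice (input $A\hat A$, output $A$) and Bob (input $B\hat B$, output $B$). Let $e_{\mathrm{PPT}}(\mathcal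 S^d_{AB},\rho_{\hat A\hat B})$ be the same infimum taken over all completely-PPT-preserving channels, i.e. quantum channels $\mathcal P_{AB\hat A\hat B\to AB}$ such that $T_{B}\circ\mathcal P\circ T_{B\hat B}$ is completely positive, where $T$ denotes the (partial) transpose on the indicated systems. The diamond distance is $\|\mathcal N-\mathcal M\|_\diamond=\sup_{\rho_{RC}}\|(\mathrm{id}_R\otimes\mathcal N)(\rho_{RC})-(\mathrm{id}_R\otimes\mathcal M)(\rho_{RC})\|_1$, the supremum being over all finite-dimensional reference systems $R$ and all states $\rho_{RC}$ of $R$ and the channel input system $C$. Then $$e_{\mathrm{PPT}}\big(\mathcal S^d_{AB},W^{(p,d_{\hat A})}_{\hat A\hat B}\big)=\begin{cases}1-\dfrac1{d^2} & \text{if } p\le \tfrac12,\\[2mm] 1-\dfrac{4p-2+d_{\hat A}}{d^2\,d_{\hat A}} & \text{if } p>\tfrac12.\end{cases}$$ Moreover, if $p\le\frac12$, then $$e_{\mathrm{PPT}}\big(\mathcal S^d_{AB},W^{(p,d_{\hat A})}_{\hat A\hat B}\big)=e_{\mathrm{LOCC}}\big(\mathcal S^d_{AB},W^{(p,d_{\hat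 A})}_{\hat A\hat B}\big).$$ -/

import Mathlib

namespace BidirTeleport

noncomputable section

open scoped ComplexOrder MatrixOrder Matrix

/-! Systems are finite index types (with their standard basis), operators are complex matrices
indexed by the basis, and maps between operators ("superoperators") are `ℂ`-linear. -/

/-- Linear operators on the Hilbert space `ℂ^A`. -/
abbrev Op (A : Type) : Type := Matrix A A ℂ

/-- Linear maps from operators on system `A` to operators on system `B`. -/
abbrev SuperOp (A B : Type) : Type := Op A →ₗ[ℂ] Op B

/-- A quantum state: a positive semi-definite operator of trace one. -/
def IsState {A : Type} [Fintype A] (ρ : Op A) : Prop :=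
  ρ.PosSemidef ∧ ρ.trace = 1

/-- `E_{A → C} ⊗ id_B`. -/
def tensorId {A C : Type} (B : Type) (E : SuperOp A C) : SuperOp (A × B) (C × B) where
  toFun X := Matrix.of fun r s => E (Matrix.of fun a a' => X (a, r.2) (a', s.2)) r.1 s.1
  map_add' X Y := by
    ext r s
    exact congrFun (congrFun (E.map_add (Matrix.of fun a a' => X (a, r.2) (a', s.2))
      (Matrix.of fun a a' => Y (a, r.2) (a', s.2))) r.1) s.1
  map_smul' c X := by
    ext r s
    exact congrFun (congrFun (E.map_smul c
      (Matrix.of fun a a' => X (a, r.2) (a', s.2))) r.1) s.1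

/-- `id_A ⊗ F_{B → D}`. -/
def idTensor {B D : Type} (A : Type) (F : SuperOp B D) : SuperOp (A × B) (A × D) where
  toFun X := Matrix.of fun r s => F (Matrix.of fun b b' => X (r.1, b) (s.1, b')) r.2 s.2
  map_add' X Y := by
    ext r s
    exact congrFun (congrFun (F.map_add (Matrix.of fun b b' => X (r.1, b) (s.1, b'))
      (Matrix.of fun b b' => Y (r.1, b) (s.1, b'))) r.2) s.2
  map_smul' c X := by
    ext r s
    exact congrFun (congrFun (F.map_smul c
      (Matrix.of fun b b' => X (r.1, b) (s.1, b'))) r.2) s.2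

/-- Complete positivity: `id_R ⊗ Φ` preserves positive semi-definiteness for every
finite-dimensional reference system `R`. -/
def IsCompletelyPositive {A B : Type} (Φ : SuperOp A B) : Prop :=
  ∀ (n : ℕ) (X : Op (Fin n × A)), X.PosSemidef → (idTensor (Fin n) Φ X).PosSemidef

def IsTracePreserving {A B : Type} [Fintype A] [Fintype B] (Φ : SuperOp A B) : Prop :=
  ∀ X : Op A, (Φ X).trace = X.trace

/-- A quantum channel: a completely positive and trace-preserving map. -/
def IsChannel {A B : Type} [Fintype A] [Fintype B] (Φ : SuperOp A B) : Prop :=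
  IsCompletelyPositive Φ ∧ IsTracePreserving Φ

/-- A quantum instrument: completely positive maps that sum to a trace-preserving map. -/
def IsInstrument {ι A C : Type} [Fintype ι] [Fintype A] [Fintype C]
    (E : ι → SuperOp A C) : Prop :=
  (∀ i, IsCompletelyPositive (E i)) ∧ IsTracePreserving (∑ i, E i)

/-- Bipartite channels `AB → A'B'` implementable by (finitely many rounds of) local operations
and classical communication. Either nothing remains to be done, or one of the two parties
applies a finite quantum instrument to its system and announces the outcome `i` to the other
party, whereupon both continue with an LOCC protocol `L i` that may depend on `i`. -/
inductive IsLOCC {A' B' : Type} [Fintype A'] [Fintype B'] :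
    ∀ {A B : Type} [Fintype A] [Fintype B], SuperOp (A × B) (A' × B') → Prop
  | done : IsLOCC (LinearMap.id : SuperOp (A' × B') (A' × B'))
  | alice {A B C ι : Type} [Fintype A] [Fintype B] [Fintype C] [Fintype ι]
      (E : ι → SuperOp A C) (L : ι → SuperOp (C × B) (A' × B')) :
      IsInstrument E → (∀ i, IsLOCC (L i)) →
      IsLOCC (∑ i, L i ∘ₗ tensorId B (E i))
  | bob {A B C ι : Type} [Fintype A] [Fintype B] [Fintype C] [Fintype ι]
      (F : ι → SuperOp B C) (L : ι → SuperOp (A × C) (A' × B')) :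
      IsInstrument F → (∀ i, IsLOCC (L i)) →
      IsLOCC (∑ i, L i ∘ₗ idTensor A (F i))

/-- The partial transpose `T_B` on operators of the bipartite system `AB`. -/
def partialTranspose (A B : Type) : SuperOp (A × B) (A × B) where
  toFun X := Matrix.of fun r s => X (r.1, s.2) (s.1, r.2)
  map_add' _ _ := rfl
  map_smul' _ _ := rfl

/-- Completely positive-partial-transpose-preserving channels: channels `P` from `AB` to `A'B'`
such that `T_{B'} ∘ P ∘ T_B` is completely positive. -/
def IsCPPTP {A B A' B' : Type} [Fintype A] [Fintype B] [Fintype A'] [Fintype B']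
    (P : SuperOp (A × B) (A' × B')) : Prop :=
  IsChannel P ∧
    IsCompletelyPositive (partialTranspose A' B' ∘ₗ P ∘ₗ partialTranspose A B)

/-- The trace norm `‖X‖₁ = Tr |X|` with `|X| = √(X† X)`. -/
def traceNorm {A : Type} [Fintype A] [DecidableEq A] (X : Op A) : ℝ :=
  (CFC.abs X).trace.re

/-- The diamond distance `‖N - M‖_⋄`: the supremum of `‖N(ρ_RC) - M(ρ_RC)‖₁` over all
finite-dimensional reference systems `R` and all states `ρ_RC`. -/
def diamondDist {C D : Type} [Fintype C] [Fintype D] [DecidableEq D]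
    (N M : SuperOp C D) : ℝ :=
  sSup {x : ℝ | ∃ (n : ℕ) (ρ : Op (Fin n × C)), IsState ρ ∧
    x = traceNorm (idTensor (Fin n) N ρ - idTensor (Fin n) M ρ)}

/-- Adjoining a resource operator: `ω_{AB} ↦ ω_{AB} ⊗ ρ_{ÂB̂}`, with the systems regrouped so
that Alice holds `AÂ` and Bob holds `BB̂`. -/
def attach {A B Ah Bh : Type} (ρ : Op (Ah × Bh)) :
    SuperOp (A × B) ((A × Ah) × (B × Bh)) where
  toFun ω := Matrix.of fun r s =>
    ω (r.1.1, r.2.1) (s.1.1, s.2.1) * ρ (r.1.2, r.2.2) (s.1.2, s.2.2)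
  map_add' X Y := by
    ext r s
    simp [add_mul]
  map_smul' c X := by
    ext r s
    simp [mul_assoc]

/-- The simulation `ω_{AB} ↦ P(ω_{AB} ⊗ ρ_{ÂB̂})`. -/
def simulation {A B Ah Bh A' B' : Type} (P : SuperOp ((A × Ah) × (B × Bh)) (A' × B'))
    (ρ : Op (Ah × Bh)) : SuperOp (A × B) (A' × B') :=
  P ∘ₗ attach ρ

/-- `e_LOCC(N, ρ)`: the least normalized diamond distance between the bipartite channel `N` and
its simulations by LOCC channels assisted by the resource state `ρ`. -/
def errorLOCC {A B Ah Bh A' B' : Type} [Fintype A] [Fintype B] [Fintype Ah] [Fintype Bh]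
    [Fintype A'] [Fintype B'] [DecidableEq A'] [DecidableEq B']
    (N : SuperOp (A × B) (A' × B')) (ρ : Op (Ah × Bh)) : ℝ :=
  ⨅ L : {L : SuperOp ((A × Ah) × (B × Bh)) (A' × B') // IsLOCC L},
    1 / 2 * diamondDist N (simulation L.1 ρ)

/-- `e_PPT(N, ρ)`: the same with C-PPT-P channels in place of LOCC channels. -/
def errorPPT {A B Ah Bh A' B' : Type} [Fintype A] [Fintype B] [Fintype Ah] [Fintype Bh]
    [Fintype A'] [Fintype B'] [DecidableEq A'] [DecidableEq B']
    (N : SuperOp (A × B) (A' × B')) (ρ : Op (Ah × Bh)) : ℝ :=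
  ⨅ P : {P : SuperOp ((A × Ah) × (B × Bh)) (A' × B') // IsCPPTP P},
    1 / 2 * diamondDist N (simulation P.1 ρ)

/-- The unitary swap operator `F = ∑ i j, |i⟩⟨j| ⊗ |j⟩⟨i|`. -/
def swapOp (d : ℕ) : Op (Fin d × Fin d) :=
  ∑ i : Fin d, ∑ j : Fin d, Matrix.single (i, j) (j, i) 1

/-- The unitary swap channel `S^d(ρ) = F ρ F†`. -/
def swapChannel (d : ℕ) : SuperOp (Fin d × Fin d) (Fin d × Fin d) where
  toFun ρ := swapOp d * ρ * (swapOp d)ᴴ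
  map_add' X Y := by simp [mul_add, add_mul]
  map_smul' c X := by simp

/-- The projection `(I + F)/2` onto the symmetric subspace. -/
def symProj (d : ℕ) : Op (Fin d × Fin d) := (1 / 2 : ℂ) • (1 + swapOp d)

/-- The projection `(I - F)/2` onto the antisymmetric subspace. -/
def antisymProj (d : ℕ) : Op (Fin d × Fin d) := (1 / 2 : ℂ) • (1 - swapOp d)

/-- The Werner state of parameter `p` on two systems of dimension `d`. -/
def wernerState (p : ℝ) (d : ℕ) : Op (Fin d × Fin d) :=
  ((1 - (p : ℂ)) * (2 / ((d : ℂ) * ((d : ℂ) + 1)))) • symProj d +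
    ((p : ℂ) * (2 / ((d : ℂ) * ((d : ℂ) - 1)))) • antisymProj d

end

end BidirTeleport

/-! *Lower bound.* Testing a simulation `P(· ⊗ ρ)` against the swap channel with the projection
onto the Choi state of the latter shows that the normalized diamond distance is at least one minus
the fidelity of the two Choi states. Partial transposition on Bob's systems preserves this
Hilbert–Schmidt pairing, turns `P` into the channel `T_B ∘ P ∘ T_B` acting on the partial
transpose of `ρ`, and turns the Choi matrix of the swap channel into a Hermitian unitary. Hence
the fidelity is at most `‖T_B ρ‖₁ / d²`. For a Werner state `‖T_B W‖₁` is `1` if `p ≤ 1/2`, and at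
most `(4p - 2 + D) / D` otherwise.

*Attaining it.* For `p ≤ 1/2`, let both parties measure in the standard basis and exchange their
outcomes: this is the swap followed by complete dephasing, and the latter is the mixture of the
identity, with weight `1/d²`, and a channel. For `p > 1/2`, measure the effect
`M = (I - (2/D) F) / d²` on the Werner state and apply the swap if it is found, which has
probability `(4p - 2 + D) / (d² D)`, and otherwise the channel whose Choi state is proportional to
the orthogonal complement of that of the swap. After conjugation by `T_B` this protocol becomes a
combination, with positive coefficients, of completely positive maps indexed by the maximally
entangled projection and its complement. -/

namespace BidirTeleport

noncomputable section

open scoped ComplexOrder MatrixOrder Matrix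

/-! ### Positive semi-definite matrices and the trace norm -/

section PosSemidef

variable {m n : Type} [Fintype n]

theorem re_trace_mul_nonneg {A B : Op n} (hA : A.PosSemidef) (hB : B.PosSemidef) :
    0 ≤ (A * B).trace.re := by
  classical
  obtain ⟨C, rfl⟩ := CStarAlgebra.nonneg_iff_eq_star_mul_self.mp hA.nonneg
  rw [mul_assoc, Matrix.trace_mul_comm]
  exact (Complex.le_def.mp (hB.mul_mul_conjTranspose_same C).trace_nonneg).1

theorem posSemidef_blockSum [Finite m] {Z : Op (m × n)} (hZ : Z.PosSemidef) :
    (Matrix.of fun r s => ∑ x, ∑ y, Z (r, x) (s, y) : Op m).PosSemidef := by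
  classical
  have := Fintype.ofFinite m
  let V : Matrix (m × n) m ℂ := Matrix.of fun p r => if p.1 = r then 1 else 0
  convert hZ.conjTranspose_mul_mul_same V using 1
  ext r s
  simp only [V, Matrix.mul_apply, Matrix.of_apply, Matrix.conjTranspose_apply, apply_ite star,
    star_one, star_zero, ite_mul, one_mul, zero_mul, mul_ite, mul_one, mul_zero,
    Fintype.sum_prod_type_right, Finset.sum_ite_eq', Finset.mem_univ, if_true]
  exact Finset.sum_comm

theorem isStarProjection_submatrix [Fintype m] {P : Op n} (hP : IsStarProjection P) (e : m ≃ n) :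
    IsStarProjection (P.submatrix e e) where
  isIdempotentElem := by
    rw [IsIdempotentElem, Matrix.submatrix_mul_equiv, hP.isIdempotentElem.eq]
  isSelfAdjoint := Matrix.IsHermitian.submatrix hP.isSelfAdjoint e

theorem posSemidef_ofReal_smul_of_isStarProjection {P : Op n} (hP : IsStarProjection P) {c : ℝ}
    (hc : 0 ≤ c) : ((c : ℂ) • P).PosSemidef :=
  (Matrix.nonneg_iff_posSemidef.mp hP.nonneg).smul (Complex.zero_le_real.mpr hc)

variable [DecidableEq n]

theorem isStarProjection_half_one_add {H : Op n} (hH : H.IsHermitian) (h : H * H = 1) :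
    IsStarProjection ((1 / 2 : ℂ) • (1 + H)) where
  isIdempotentElem := by
    rw [IsIdempotentElem, smul_mul_smul_comm, add_mul, mul_add, mul_add, h, one_mul, one_mul,
      mul_one]
    module
  isSelfAdjoint := IsSelfAdjoint.smul (by simp [IsSelfAdjoint]) (.add (.one _) hH)

theorem neg_one_le_of_mul_self_eq_one {H : Op n} (hH : H.IsHermitian) (h : H * H = 1) :
    -1 ≤ H := by
  have h2 : H - -1 = (2 : ℝ) • ((1 / 2 : ℂ) • (1 + H)) := by module
  rw [← sub_nonneg, h2]
  exact smul_nonneg zero_le_two (isStarProjection_half_one_add hH h).nonneg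

theorem le_one_of_mul_self_eq_one {H : Op n} (hH : H.IsHermitian) (h : H * H = 1) : H ≤ 1 :=
  neg_le_neg_iff.mp (neg_one_le_of_mul_self_eq_one hH.neg (by rwa [neg_mul_neg]))

omit [Fintype n] in
theorem one_add_smul_nonneg [Finite n] {H : Op n} (hH : -1 ≤ H) (hH' : H ≤ 1) {c : ℝ}
    (hc : -1 ≤ c) (hc' : c ≤ 1) : 0 ≤ 1 + (c : ℂ) • H := by
  have := Fintype.ofFinite n
  have h : 1 + (c : ℂ) • H = ((1 + c) / 2) • (H - -1) + ((1 - c) / 2) • (1 - H) := by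
    rw [← Complex.coe_smul, ← Complex.coe_smul]
    push_cast
    module
  rw [h]
  exact add_nonneg (smul_nonneg (by linarith) (sub_nonneg.mpr hH))
    (smul_nonneg (by linarith) (sub_nonneg.mpr hH'))

theorem re_trace_mul_sub_le {H ρ σ : Op n} (hH : -1 ≤ H) (hH' : H ≤ 1) (hρ : ρ.PosSemidef)
    (hσ : σ.PosSemidef) : (H * (ρ - σ)).trace.re ≤ ρ.trace.re + σ.trace.re := by
  have h1 := re_trace_mul_nonneg (Matrix.le_iff.mp hH') hρ
  have h2 := re_trace_mul_nonneg (Matrix.le_iff.mp hH) hσ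
  simp only [mul_sub, sub_mul, add_mul, one_mul, sub_neg_eq_add, Matrix.trace_sub,
    Matrix.trace_add, Complex.sub_re, Complex.add_re] at h1 h2 ⊢
  linarith

end PosSemidef

section TraceNorm

variable {A : Type} [Fintype A] [DecidableEq A] {X : Op A}

theorem traceNorm_of_posSemidef (hX : X.PosSemidef) : traceNorm X = X.trace.re := by
  rw [traceNorm, CFC.abs_of_nonneg X hX.nonneg]

theorem traceNorm_nonneg (X : Op A) : 0 ≤ traceNorm X :=
  (Complex.le_def.mp (Matrix.nonneg_iff_posSemidef.mp (CFC.abs_nonneg X)).trace_nonneg).1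

theorem traceNorm_eq_posPart_add_negPart (hX : X.IsHermitian) :
    traceNorm X = (X⁺).trace.re + (X⁻).trace.re := by
  rw [traceNorm, ← CFC.posPart_add_negPart X hX, Matrix.trace_add, Complex.add_re]

theorem re_trace_mul_le_traceNorm (hX : X.IsHermitian) {H : Op A} (hH : -1 ≤ H) (hH' : H ≤ 1) :
    (H * X).trace.re ≤ traceNorm X := by
  rw [traceNorm_eq_posPart_add_negPart hX]
  nth_rw 1 [← CFC.posPart_sub_negPart X hX]
  exact re_trace_mul_sub_le hH hH' (Matrix.nonneg_iff_posSemidef.mp (CFC.posPart_nonneg X))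
    (Matrix.nonneg_iff_posSemidef.mp (CFC.negPart_nonneg X))

theorem exists_abs_eq_mul (hX : X.IsHermitian) :
    ∃ U : Op A, -1 ≤ U ∧ U ≤ 1 ∧ CFC.abs X = U * X := by
  have hXs : IsSelfAdjoint X := hX
  have hcont (f : ℝ → ℝ) : ContinuousOn f (spectrum ℝ X) :=
    (Matrix.finite_real_spectrum (A := X)).continuousOn f
  let sgn : ℝ → ℝ := fun x => SignType.sign x
  refine ⟨cfc sgn X, ?_, ?_, ?_⟩
  · rw [← map_one (algebraMap ℝ (Op A)), ← map_neg]
    refine algebraMap_le_cfc _ _ X (fun x _ => ?_) (hcont _)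
    rcases lt_trichotomy x 0 with h | rfl | h <;> simp [sgn, *]
  · refine cfc_le_one _ X fun x _ => ?_
    rcases lt_trichotomy x 0 with h | rfl | h <;> simp [sgn, *]
  · have hmul := cfc_mul sgn (fun x => x) X (hcont _) (hcont _)
    rw [cfc_id' ℝ X hXs] at hmul
    rw [CFC.abs_eq_cfc_norm X hXs, ← hmul]
    exact cfc_congr fun x _ => (sign_mul_self x).symm

theorem traceNorm_sub_le {ρ σ : Op A} (hρ : ρ.PosSemidef) (hσ : σ.PosSemidef) :
    traceNorm (ρ - σ) ≤ ρ.trace.re + σ.trace.re := by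
  obtain ⟨U, hU, hU', hX⟩ := exists_abs_eq_mul (hρ.isHermitian.sub hσ.isHermitian)
  rw [traceNorm, hX]
  exact re_trace_mul_sub_le hU hU' hρ hσ

theorem two_mul_re_trace_mul_le_traceNorm (hX : X.IsHermitian) (hX0 : X.trace = 0) {P : Op A}
    (hP : 0 ≤ P) (hP' : P ≤ 1) : 2 * (P * X).trace.re ≤ traceNorm X := by
  have h := re_trace_mul_le_traceNorm hX (H := P + P - 1) (by simpa using add_nonneg hP hP)
    (sub_le_iff_le_add.mpr (add_le_add hP' hP'))
  rwa [sub_mul, one_mul, Matrix.trace_sub, hX0, sub_zero, add_mul, Matrix.trace_add,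
    Complex.add_re, ← two_mul] at h

end TraceNorm

/-! ### Completely positive maps and Choi matrices -/

section CompletelyPositive

variable {A B C D : Type}

theorem idTensor_sum {ι : Type} (s : Finset ι) (R : Type) (Φ : ι → SuperOp A B) :
    idTensor R (∑ i ∈ s, Φ i) = ∑ i ∈ s, idTensor R (Φ i) := by
  ext X r s
  simp only [idTensor, LinearMap.coe_mk, AddHom.coe_mk, Matrix.of_apply, LinearMap.sum_apply,
    Matrix.sum_apply]

theorem tensorId_sum {ι : Type} (s : Finset ι) (R : Type) (Φ : ι → SuperOp A B) :
    tensorId R (∑ i ∈ s, Φ i) = ∑ i ∈ s, tensorId R (Φ i) := by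
  ext X r s
  simp only [tensorId, LinearMap.coe_mk, AddHom.coe_mk, Matrix.of_apply, LinearMap.sum_apply,
    Matrix.sum_apply]

theorem IsCompletelyPositive.idTensor_posSemidef {R : Type} [Finite R] {Φ : SuperOp A B}
    (hΦ : IsCompletelyPositive Φ) {X : Op (R × A)} (hX : X.PosSemidef) :
    (idTensor R Φ X).PosSemidef := by
  let e := Finite.equivFin R
  convert (hΦ _ _ (hX.submatrix (Prod.map e.symm id))).submatrix (Prod.map e id) using 1
  ext r s
  simp [idTensor]

theorem isCompletelyPositive_id : IsCompletelyPositive (LinearMap.id : SuperOp A A) :=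
  fun _ _ hX => hX

theorem IsCompletelyPositive.comp {Φ : SuperOp A B} {Ψ : SuperOp B C}
    (hΨ : IsCompletelyPositive Ψ) (hΦ : IsCompletelyPositive Φ) :
    IsCompletelyPositive (Ψ ∘ₗ Φ) :=
  fun n X hX => hΨ n _ (hΦ n X hX)

theorem IsCompletelyPositive.add {Φ Ψ : SuperOp A B}
    (hΦ : IsCompletelyPositive Φ) (hΨ : IsCompletelyPositive Ψ) :
    IsCompletelyPositive (Φ + Ψ) :=
  fun n X hX => (hΦ n X hX).add (hΨ n X hX)

theorem IsCompletelyPositive.smul {Φ : SuperOp A B} (hΦ : IsCompletelyPositive Φ) {c : ℝ}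
    (hc : 0 ≤ c) : IsCompletelyPositive ((c : ℂ) • Φ) :=
  fun n X hX => (hΦ n X hX).smul (Complex.zero_le_real.mpr hc)

theorem isCompletelyPositive_sum {ι : Type} {s : Finset ι} {Φ : ι → SuperOp A B}
    (h : ∀ i ∈ s, IsCompletelyPositive (Φ i)) : IsCompletelyPositive (∑ i ∈ s, Φ i) := by
  intro n X hX
  rw [idTensor_sum, LinearMap.sum_apply]
  exact Matrix.posSemidef_sum _ fun i hi => h i hi n X hX

theorem IsCompletelyPositive.idTensor {F : SuperOp B D} (hF : IsCompletelyPositive F)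
    (A : Type) [Finite A] : IsCompletelyPositive (idTensor A F) := fun n _ hX =>
  (hF.idTensor_posSemidef (R := Fin n × A)
    (hX.submatrix fun p : (Fin n × A) × B => (p.1.1, p.1.2, p.2))).submatrix
      fun p : Fin n × A × D => ((p.1, p.2.1), p.2.2)

theorem IsCompletelyPositive.tensorId {E : SuperOp A C} (hE : IsCompletelyPositive E)
    (B : Type) [Finite B] : IsCompletelyPositive (tensorId B E) := fun n _ hX =>
  (hE.idTensor_posSemidef (R := Fin n × B)
    (hX.submatrix fun p : (Fin n × B) × A => (p.1.1, p.2, p.1.2))).submatrix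
      fun p : Fin n × C × B => ((p.1, p.2.2), p.2.1)

theorem isCompletelyPositive_of_hadamard {Φ : SuperOp A A} {M : Op A} (hM : M.PosSemidef)
    (h : ∀ X, Φ X = X ⊙ M) : IsCompletelyPositive Φ := by
  intro n X hX
  have hmul : BidirTeleport.idTensor (Fin n) Φ X = X ⊙ M.submatrix Prod.snd Prod.snd := by
    ext r s
    simp only [BidirTeleport.idTensor, h, LinearMap.coe_mk, AddHom.coe_mk, Matrix.of_apply,
      Matrix.hadamard_apply, Matrix.submatrix_apply]
  rw [hmul]
  exact hX.hadamard (hM.submatrix Prod.snd)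

/-- Conjugation of `Φ` by the transposition, which replaces the Choi matrix of `Φ` by its transpose:
`X ↦ (Φ(Xᵀ))ᵀ`. -/
def transposeConj (Φ : SuperOp A B) : SuperOp A B where
  toFun X := (Φ Xᵀ)ᵀ
  map_add' X Y := by simp
  map_smul' c X := by simp

theorem IsCompletelyPositive.transposeConj {Φ : SuperOp A B} (hΦ : IsCompletelyPositive Φ) :
    IsCompletelyPositive (transposeConj Φ) :=
  fun n X hX => (hΦ n Xᵀ hX.transpose).transpose

end CompletelyPositive

section Choi

variable {A B C : Type} [DecidableEq A]

/-- The Choi matrix `∑ |a⟩⟨a'| ⊗ Φ(|a⟩⟨a'|)` of a superoperator. -/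
def choi (Φ : SuperOp A B) : Op (A × B) :=
  Matrix.of fun r s => Φ (Matrix.single r.1 s.1 1) r.2 s.2

theorem choi_apply (Φ : SuperOp A B) (r s : A × B) :
    choi Φ r s = Φ (Matrix.single r.1 s.1 1) r.2 s.2 := rfl

theorem choi_comp (Ψ : SuperOp B C) (Φ : SuperOp A B) :
    choi (Ψ ∘ₗ Φ) = idTensor A Ψ (choi Φ) := rfl

theorem choi_sub (Φ Ψ : SuperOp A B) : choi (Φ - Ψ) = choi Φ - choi Ψ := rfl

theorem choi_add (Φ Ψ : SuperOp A B) : choi (Φ + Ψ) = choi Φ + choi Ψ := rfl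

theorem choi_smul (c : ℂ) (Φ : SuperOp A B) : choi (c • Φ) = c • choi Φ := rfl

theorem choi_id_apply (r s : A × A) :
    choi (LinearMap.id : SuperOp A A) r s = if r.1 = r.2 ∧ s.1 = s.2 then 1 else 0 := by
  rw [choi_apply, LinearMap.id_apply, Matrix.single_apply]

theorem choi_id_eq_vecMulVec : choi (LinearMap.id : SuperOp A A) =
    Matrix.vecMulVec (fun r => if r.1 = r.2 then 1 else 0)
      (star fun r => if r.1 = r.2 then 1 else 0) := by
  ext r s
  rw [choi_id_apply, Matrix.vecMulVec_apply, Pi.star_apply, apply_ite star, star_one, star_zero,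
    ite_zero_mul_ite_zero, one_mul]

theorem apply_eq_sum_choi [Fintype A] (Φ : SuperOp A B) (X : Op A) (b b' : B) :
    Φ X b b' = ∑ a, ∑ a', X a a' * choi Φ (a, b) (a', b') := by
  conv_lhs => rw [Matrix.matrix_eq_sum_single X]
  simp only [map_sum, Matrix.sum_apply]
  refine Finset.sum_congr rfl fun a _ => Finset.sum_congr rfl fun a' _ => ?_
  rw [← mul_one (X a a'), ← smul_eq_mul, ← Matrix.smul_single, map_smul, Matrix.smul_apply,
    smul_eq_mul, smul_eq_mul, mul_one, choi_apply]

theorem isCompletelyPositive_iff_posSemidef_choi [Finite A] [Finite B] {Φ : SuperOp A B} :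
    IsCompletelyPositive Φ ↔ (choi Φ).PosSemidef := by
  have := Fintype.ofFinite A
  refine ⟨fun hΦ => ?_, fun hΦ n X hX => ?_⟩
  · rw [← Φ.comp_id, choi_comp, choi_id_eq_vecMulVec]
    exact hΦ.idTensor_posSemidef (Matrix.posSemidef_vecMulVec_self_star _)
  · convert posSemidef_blockSum
      ((hX.submatrix fun p : (Fin n × B) × A => (p.1.1, p.2)).hadamard
        (hΦ.submatrix fun p : (Fin n × B) × A => (p.2, p.1.2))) using 1
    ext r s
    exact apply_eq_sum_choi Φ _ _ _

variable [Fintype A]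

theorem trace_choi [Fintype B] (Φ : SuperOp A B) : (choi Φ).trace = (Φ 1).trace := by
  simp only [← Matrix.sum_single_one, map_sum, Matrix.trace_sum]
  exact Fintype.sum_prod_type _

theorem choi_id_mul_self : choi (LinearMap.id : SuperOp A A) * choi LinearMap.id =
    (Fintype.card A : ℂ) • choi LinearMap.id := by
  rw [choi_id_eq_vecMulVec, Matrix.vecMulVec_mul_vecMulVec, Matrix.vecMulVec_smul]
  congr 1
  simp [dotProduct, apply_ite star, Fintype.sum_prod_type]

/-- The Choi state of `Φ`: the image of the maximally entangled state under `id ⊗ Φ`. -/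
def choiState (Φ : SuperOp A B) : Op (A × B) := (Fintype.card A : ℂ)⁻¹ • choi Φ

/-- The maximally entangled state on two copies of `A`. -/
def maxEntangled (A : Type) [Fintype A] [DecidableEq A] : Op (A × A) :=
  choiState LinearMap.id

theorem idTensor_maxEntangled (Φ : SuperOp A B) :
    idTensor A Φ (maxEntangled A) = choiState Φ := by
  rw [maxEntangled, choiState, map_smul, ← choi_comp, Φ.comp_id, choiState]

theorem isStarProjection_maxEntangled : IsStarProjection (maxEntangled A) where
  isIdempotentElem := by
    rw [IsIdempotentElem, maxEntangled, choiState, smul_mul_smul_comm, choi_id_mul_self,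
      smul_smul, mul_right_comm]
    congr 1
    simpa only [inv_inv] using mul_inv_mul_cancel (Fintype.card A : ℂ)⁻¹
  isSelfAdjoint := by
    refine IsSelfAdjoint.smul (by simp [IsSelfAdjoint]) ?_
    exact (isCompletelyPositive_iff_posSemidef_choi.mp isCompletelyPositive_id).isHermitian

end Choi

/-! ### Channels and the diamond distance -/

section Channels

variable {A B C D : Type} [Fintype A] [Fintype B] [Fintype C] [Fintype D]

theorem trace_submatrix_equiv (e : A ≃ B) (X : Op B) : (X.submatrix e e).trace = X.trace :=
  Equiv.sum_comp e fun i => X i i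

theorem isState_single [DecidableEq C] (c : C) : IsState (Matrix.single c c (1 : ℂ)) := by
  refine ⟨?_, Matrix.trace_single_eq_same c 1⟩
  rw [← Matrix.diagonal_single]
  exact Matrix.PosSemidef.diagonal (Pi.single_nonneg.mpr zero_le_one)

theorem IsTracePreserving.idTensor {F : SuperOp B D} (hF : IsTracePreserving F)
    (A : Type) [Fintype A] : IsTracePreserving (idTensor A F) := by
  intro X
  simp only [Matrix.trace, Matrix.diag, Fintype.sum_prod_type]
  exact Finset.sum_congr rfl fun a _ => hF (Matrix.of fun b b' => X (a, b) (a, b'))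

theorem IsTracePreserving.tensorId {E : SuperOp A C} (hE : IsTracePreserving E)
    (B : Type) [Fintype B] : IsTracePreserving (tensorId B E) := by
  intro X
  simp only [Matrix.trace, Matrix.diag, Fintype.sum_prod_type_right]
  exact Finset.sum_congr rfl fun b _ => hE (Matrix.of fun a a' => X (a, b) (a', b))

theorem IsTracePreserving.comp {Φ : SuperOp A B} {Ψ : SuperOp B C}
    (hΨ : IsTracePreserving Ψ) (hΦ : IsTracePreserving Φ) : IsTracePreserving (Ψ ∘ₗ Φ) :=
  fun X => (hΨ _).trans (hΦ X)

theorem isChannel_id : IsChannel (LinearMap.id : SuperOp A A) :=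
  ⟨isCompletelyPositive_id, fun _ => rfl⟩

theorem IsChannel.comp {Φ : SuperOp A B} {Ψ : SuperOp B C}
    (hΨ : IsChannel Ψ) (hΦ : IsChannel Φ) : IsChannel (Ψ ∘ₗ Φ) :=
  ⟨hΨ.1.comp hΦ.1, hΨ.2.comp hΦ.2⟩

theorem IsChannel.isState_idTensor {R : Type} [Fintype R] {Φ : SuperOp A B} (hΦ : IsChannel Φ)
    {ρ : Op (R × A)} (hρ : IsState ρ) : IsState (idTensor R Φ ρ) :=
  ⟨hΦ.1.idTensor_posSemidef hρ.1, (hΦ.2.idTensor R ρ).trans hρ.2⟩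

theorem IsChannel.isState_choiState [DecidableEq A] [Nonempty A] {Φ : SuperOp A B}
    (hΦ : IsChannel Φ) : IsState (choiState Φ) := by
  refine ⟨(isCompletelyPositive_iff_posSemidef_choi.mp hΦ.1).smul (by positivity), ?_⟩
  rw [choiState, Matrix.trace_smul, trace_choi, hΦ.2, Matrix.trace_one, smul_eq_mul,
    inv_mul_cancel₀ (by simp)]

theorem isState_maxEntangled [DecidableEq A] [Nonempty A] : IsState (maxEntangled A) :=
  isChannel_id.isState_choiState

theorem IsInstrument.isChannel_sum_comp {ι : Type} [Fintype ι] {E : ι → SuperOp A B}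
    (hE : IsInstrument E) {L : ι → SuperOp B C} (hL : ∀ i, IsChannel (L i)) :
    IsChannel (∑ i, L i ∘ₗ E i) := by
  refine ⟨isCompletelyPositive_sum fun i _ => (hL i).1.comp (hE.1 i), fun X => ?_⟩
  rw [← hE.2 X]
  simp only [LinearMap.sum_apply, Matrix.trace_sum, LinearMap.comp_apply, (hL _).2 _]

theorem IsInstrument.tensorId {ι : Type} [Fintype ι] {E : ι → SuperOp A C} (hE : IsInstrument E)
    (B : Type) [Fintype B] : IsInstrument fun i => tensorId B (E i) :=
  ⟨fun i => (hE.1 i).tensorId B, tensorId_sum _ B E ▸ hE.2.tensorId B⟩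

theorem IsInstrument.idTensor {ι : Type} [Fintype ι] {F : ι → SuperOp B D} (hF : IsInstrument F)
    (A : Type) [Fintype A] : IsInstrument fun i => idTensor A (F i) :=
  ⟨fun i => (hF.1 i).idTensor A, idTensor_sum _ A F ▸ hF.2.idTensor A⟩

variable [DecidableEq D] {N M : SuperOp C D}

theorem diamondDist_nonneg (N M : SuperOp C D) : 0 ≤ diamondDist N M := by
  refine Real.sSup_nonneg ?_
  rintro x ⟨n, ρ, -, rfl⟩
  exact traceNorm_nonneg _

theorem traceNorm_le_diamondDist (hN : IsChannel N) (hM : IsChannel M) {n : ℕ}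
    {ρ : Op (Fin n × C)} (hρ : IsState ρ) :
    traceNorm (idTensor (Fin n) N ρ - idTensor (Fin n) M ρ) ≤ diamondDist N M := by
  refine le_csSup ⟨2, ?_⟩ ⟨n, ρ, hρ, rfl⟩
  rintro x ⟨k, σ, hσ, rfl⟩
  obtain ⟨hNσ, hNσ1⟩ := hN.isState_idTensor hσ
  obtain ⟨hMσ, hMσ1⟩ := hM.isState_idTensor hσ
  calc
    _ ≤ _ := traceNorm_sub_le hNσ hMσ
    _ = 2 := by rw [hNσ1, hMσ1, Complex.one_re, one_add_one_eq_two]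

theorem diamondDist_le_of_isCompletelyPositive_sub (hN : IsChannel N) (hM : IsTracePreserving M)
    {f : ℝ} (hf : f ≤ 1) (h : IsCompletelyPositive (M - (f : ℂ) • N)) :
    diamondDist N M ≤ 2 * (1 - f) := by
  refine Real.sSup_le ?_ (by linarith)
  rintro x ⟨n, ρ, hρ, rfl⟩
  have hf' : 0 ≤ 1 - f := sub_nonneg.mpr hf
  set σ := idTensor (Fin n) N ρ
  set E := idTensor (Fin n) (M - (f : ℂ) • N) ρ
  have hσ : IsState σ := hN.isState_idTensor hρ
  have hME : idTensor (Fin n) M ρ = E + (f : ℂ) • σ := (sub_add_cancel _ ((f : ℂ) • σ)).symm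
  have hEtr : E.trace = ((1 - f : ℝ) : ℂ) := by
    have htr := (hM.idTensor (Fin n) ρ).trans hρ.2
    rw [hME, Matrix.trace_add, Matrix.trace_smul, hσ.2, smul_eq_mul, mul_one] at htr
    rw [eq_sub_of_add_eq htr, Complex.ofReal_sub, Complex.ofReal_one]
  have hdiff : σ - idTensor (Fin n) M ρ = ((1 - f : ℝ) : ℂ) • σ - E := by
    rw [hME, Complex.ofReal_sub, Complex.ofReal_one, sub_smul, one_smul]
    abel
  calc
    traceNorm (σ - idTensor (Fin n) M ρ)
        ≤ (((1 - f : ℝ) : ℂ) • σ).trace.re + E.trace.re := hdiff ▸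
          traceNorm_sub_le (hσ.1.smul (Complex.zero_le_real.mpr hf')) (h.idTensor_posSemidef hρ.1)
    _ = 2 * (1 - f) := by
      rw [Matrix.trace_smul, hσ.2, hEtr, smul_eq_mul, mul_one, Complex.ofReal_re, two_mul]

theorem two_mul_re_trace_mul_le_diamondDist {R : Type} [Fintype R] (hN : IsChannel N)
    (hM : IsChannel M) {ρ : Op (R × C)} (hρ : IsState ρ) {P : Op (R × D)}
    (hP : IsStarProjection P) :
    2 * (P * (idTensor R N ρ - idTensor R M ρ)).trace.re ≤ diamondDist N M := by
  classical
  let e := (Fintype.equivFin R).symm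
  let eC : Fin (Fintype.card R) × C ≃ R × C := e.prodCongr (Equiv.refl C)
  let eD : Fin (Fintype.card R) × D ≃ R × D := e.prodCongr (Equiv.refl D)
  have hρ' : IsState (ρ.submatrix eC eC) :=
    ⟨hρ.1.submatrix _, (trace_submatrix_equiv eC ρ).trans hρ.2⟩
  obtain ⟨hNρ, hNρ1⟩ := hN.isState_idTensor hρ'
  obtain ⟨hMρ, hMρ1⟩ := hM.isState_idTensor hρ'
  have hP' := isStarProjection_submatrix hP eD
  have hbound := two_mul_re_trace_mul_le_traceNorm (hNρ.isHermitian.sub hMρ.isHermitian)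
    (by rw [Matrix.trace_sub, hNρ1, hMρ1, sub_self]) hP'.nonneg hP'.le_one
  have hsub : idTensor _ N (ρ.submatrix eC eC) - idTensor _ M (ρ.submatrix eC eC)
      = (idTensor R N ρ - idTensor R M ρ).submatrix eD eD := rfl
  refine le_trans (le_of_eq ?_) (hbound.trans (traceNorm_le_diamondDist hN hM hρ'))
  rw [hsub, Matrix.submatrix_mul_equiv, trace_submatrix_equiv]

/-- The test is the projection onto the Choi state of `N`, so the trace on the left-hand side is
the entanglement fidelity when `N` is unitary. -/
theorem one_sub_re_trace_choiState_mul_le [DecidableEq C] [Nonempty C] (hN : IsChannel N)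
    (hM : IsChannel M) (hP : IsStarProjection (choiState N)) :
    1 - (choiState N * choiState M).trace.re ≤ 1 / 2 * diamondDist N M := by
  have h := two_mul_re_trace_mul_le_diamondDist hN hM isState_maxEntangled hP
  rw [idTensor_maxEntangled, idTensor_maxEntangled, mul_sub, hP.isIdempotentElem.eq,
    Matrix.trace_sub, hN.isState_choiState.2, Complex.sub_re, Complex.one_re] at h
  linarith

end Channels

/-! ### LOCC and completely PPT preserving channels -/

section PartialTranspose

variable {A B A' B' C D : Type}

theorem partialTranspose_apply (X : Op (A × B)) (r s : A × B) :
    partialTranspose A B X r s = X (r.1, s.2) (s.1, r.2) := rfl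

theorem trace_partialTranspose [Fintype A] [Fintype B] (X : Op (A × B)) :
    (partialTranspose A B X).trace = X.trace := rfl

theorem partialTranspose_isHermitian {X : Op (A × B)} (hX : X.IsHermitian) :
    (partialTranspose A B X).IsHermitian := by
  ext r s
  exact hX.apply (r.1, s.2) (s.1, r.2)

theorem partialTranspose_one [DecidableEq A] [DecidableEq B] :
    partialTranspose A B 1 = 1 := by
  ext r s
  simp only [partialTranspose_apply, Matrix.one_apply, Prod.ext_iff, eq_comm (a := s.2)]

/-- The superoperator `T_{B'} ∘ P ∘ T_B` whose complete positivity makes `P` completely PPT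
preserving. -/
def ptConj (P : SuperOp (A × B) (A' × B')) : SuperOp (A × B) (A' × B') :=
  partialTranspose A' B' ∘ₗ P ∘ₗ partialTranspose A B

theorem ptConj_tensorId (B : Type) (E : SuperOp A A') : ptConj (tensorId B E) = tensorId B E := rfl

theorem ptConj_idTensor (A : Type) (F : SuperOp B B') :
    ptConj (idTensor A F) = idTensor A (transposeConj F) := rfl

theorem ptConj_comp (Q : SuperOp (C × D) (A' × B')) (P : SuperOp (A × B) (C × D)) :
    ptConj (Q ∘ₗ P) = ptConj Q ∘ₗ ptConj P := rfl

theorem ptConj_add (P Q : SuperOp (A × B) (A' × B')) :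
    ptConj (P + Q) = ptConj P + ptConj Q := rfl

theorem ptConj_sub (P Q : SuperOp (A × B) (A' × B')) :
    ptConj (P - Q) = ptConj P - ptConj Q := rfl

theorem ptConj_smul (c : ℂ) (P : SuperOp (A × B) (A' × B')) : ptConj (c • P) = c • ptConj P := rfl

theorem ptConj_sum {ι : Type} (s : Finset ι) (P : ι → SuperOp (A × B) (A' × B')) :
    ptConj (∑ i ∈ s, P i) = ∑ i ∈ s, ptConj (P i) := by
  ext1 X
  simp only [ptConj, LinearMap.comp_apply, LinearMap.sum_apply, map_sum]

theorem ptConj_attach (ρ : Op (C × D)) :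
    ptConj (attach (A := A) (B := B) ρ) = attach (partialTranspose C D ρ) := rfl

variable [Fintype A] [Fintype B] [Fintype A'] [Fintype B']

theorem IsTracePreserving.ptConj {P : SuperOp (A × B) (A' × B')} (hP : IsTracePreserving P) :
    IsTracePreserving (ptConj P) := fun X => hP (partialTranspose A B X)

/-- A map on Alice's side commutes with the partial transposes, and a map on Bob's side is
conjugated by a full transpose; neither spoils complete positivity. -/
theorem IsLOCC.isCPPTP {P : SuperOp (A × B) (A' × B')} (hP : IsLOCC P) : IsCPPTP P := by
  induction hP with
  | done => exact ⟨isChannel_id, isCompletelyPositive_id⟩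
  | @alice A B C ι _ _ _ _ E L hE _ ih =>
    refine ⟨(hE.tensorId B).isChannel_sum_comp fun i => (ih i).1, ?_⟩
    rw [← BidirTeleport.ptConj, ptConj_sum]
    simp only [ptConj_comp, ptConj_tensorId]
    exact isCompletelyPositive_sum fun i _ => (ih i).2.comp ((hE.1 i).tensorId B)
  | @bob A B C ι _ _ _ _ F L hF _ ih =>
    refine ⟨(hF.idTensor A).isChannel_sum_comp fun i => (ih i).1, ?_⟩
    rw [← BidirTeleport.ptConj, ptConj_sum]
    simp only [ptConj_comp, ptConj_idTensor]
    exact isCompletelyPositive_sum fun i _ => (ih i).2.comp ((hF.1 i).transposeConj.idTensor A)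

end PartialTranspose

section Attach

variable {A B Ah Bh : Type}

theorem isCompletelyPositive_attach {ρ : Op (Ah × Bh)} (hρ : ρ.PosSemidef) :
    IsCompletelyPositive (attach (A := A) (B := B) ρ) := fun n _ hX =>
  (hX.submatrix fun p : Fin n × (A × Ah) × (B × Bh) => (p.1, p.2.1.1, p.2.2.1)).hadamard
    (hρ.submatrix fun p : Fin n × (A × Ah) × (B × Bh) => (p.2.1.2, p.2.2.2))

theorem attach_sub (ρ σ : Op (Ah × Bh)) :
    attach (A := A) (B := B) (ρ - σ) = attach ρ - attach σ := by
  ext X r s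
  exact mul_sub _ _ _

variable [Fintype A] [Fintype B] [Fintype Ah] [Fintype Bh]

theorem trace_attach (ρ : Op (Ah × Bh)) (X : Op (A × B)) :
    (attach ρ X).trace = X.trace * ρ.trace := by
  simp only [Matrix.trace, Matrix.diag, attach, LinearMap.coe_mk, AddHom.coe_mk, Matrix.of_apply,
    Fintype.sum_prod_type, Finset.sum_mul_sum]

theorem isChannel_attach {ρ : Op (Ah × Bh)} (hρ : IsState ρ) :
    IsChannel (attach (A := A) (B := B) ρ) :=
  ⟨isCompletelyPositive_attach hρ.1, fun X => by rw [trace_attach, hρ.2, mul_one]⟩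

end Attach

section Errors

variable {A B Ah Bh A' B' : Type} [Fintype A] [Fintype B] [Fintype Ah] [Fintype Bh]
    [Fintype A'] [Fintype B'] [DecidableEq A'] [DecidableEq B']
    (N : SuperOp (A × B) (A' × B')) (ρ : Op (Ah × Bh))
    {P L : SuperOp ((A × Ah) × (B × Bh)) (A' × B')}

theorem bddBelow_range_half_diamondDist {ι : Sort*} (M : ι → SuperOp (A × B) (A' × B')) :
    BddBelow (Set.range fun i => 1 / 2 * diamondDist N (M i)) := by
  refine ⟨0, ?_⟩
  rintro _ ⟨i, rfl⟩
  exact mul_nonneg one_half_pos.le (diamondDist_nonneg _ _)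

theorem errorPPT_le (hP : IsCPPTP P) :
    errorPPT N ρ ≤ 1 / 2 * diamondDist N (simulation P ρ) :=
  ciInf_le (bddBelow_range_half_diamondDist N _) (⟨P, hP⟩ : {P // IsCPPTP P})

theorem errorLOCC_le (hL : IsLOCC L) :
    errorLOCC N ρ ≤ 1 / 2 * diamondDist N (simulation L ρ) :=
  ciInf_le (bddBelow_range_half_diamondDist N _) (⟨L, hL⟩ : {L // IsLOCC L})

theorem errorPPT_le_errorLOCC (hL : IsLOCC L) : errorPPT N ρ ≤ errorLOCC N ρ := by
  have : Nonempty {L : SuperOp ((A × Ah) × (B × Bh)) (A' × B') // IsLOCC L} := ⟨⟨L, hL⟩⟩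
  exact le_ciInf fun L => errorPPT_le N ρ L.2.isCPPTP

end Errors

/-! ### The negativity bound -/

section Negativity

variable {A B A' B' Ah Bh : Type} [DecidableEq A] [DecidableEq B]

theorem partialTranspose_single (r s : A × B) (c : ℂ) :
    partialTranspose A B (Matrix.single r s c) = Matrix.single (r.1, s.2) (s.1, r.2) c := by
  ext x y
  simp only [partialTranspose_apply, Matrix.single_apply, Prod.ext_iff]
  exact if_congr (by tauto) rfl rfl

theorem choi_ptConj_apply (Φ : SuperOp (A × B) (A' × B')) (r s : (A × B) × (A' × B')) :
    choi (ptConj Φ) r s = choi Φ ((r.1.1, s.1.2), (r.2.1, s.2.2))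
      ((s.1.1, r.1.2), (s.2.1, r.2.2)) := by
  rw [choi_apply, ptConj, LinearMap.comp_apply, LinearMap.comp_apply, partialTranspose_single]
  rfl

variable [Fintype A] [Fintype B] [Fintype A'] [Fintype B']

theorem trace_choi_ptConj_mul_choi_ptConj (Φ Ψ : SuperOp (A × B) (A' × B')) :
    (choi (ptConj Φ) * choi (ptConj Ψ)).trace = (choi Φ * choi Ψ).trace := by
  let swapBob : Equiv.Perm (((A × B) × (A' × B')) × ((A × B) × (A' × B'))) :=
    Function.Involutive.toPerm (fun z =>
      (((z.1.1.1, z.2.1.2), (z.1.2.1, z.2.2.2)), ((z.2.1.1, z.1.1.2), (z.2.2.1, z.1.2.2))))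
      fun _ => rfl
  simp only [Matrix.trace, Matrix.diag, Matrix.mul_apply, choi_ptConj_apply]
  rw [← Fintype.sum_prod_type', ← Fintype.sum_prod_type']
  exact Fintype.sum_equiv swapBob _ _ fun _ => rfl

variable [Fintype Ah] [Fintype Bh]

theorem trace_choi_comp_attach {Q : SuperOp ((A × Ah) × (B × Bh)) (A' × B')}
    (hQ : IsTracePreserving Q) (R : Op (Ah × Bh)) :
    (choi (Q ∘ₗ attach R)).trace = Fintype.card (A × B) * R.trace := by
  rw [trace_choi, LinearMap.comp_apply, hQ, trace_attach, Matrix.trace_one]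

variable [DecidableEq A'] [DecidableEq B'] [DecidableEq Ah] [DecidableEq Bh]

theorem re_trace_mul_choi_comp_attach_le {Q : SuperOp ((A × Ah) × (B × Bh)) (A' × B')}
    (hQ : IsChannel Q) {R : Op (Ah × Bh)} (hR : R.IsHermitian) {H : Op ((A × B) × (A' × B'))}
    (hH : -1 ≤ H) (hH' : H ≤ 1) :
    (H * choi (Q ∘ₗ attach R)).trace.re ≤ Fintype.card (A × B) * traceNorm R := by
  have hpsd {S : Op (Ah × Bh)} (hS : 0 ≤ S) : (choi (Q ∘ₗ attach S)).PosSemidef :=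
    isCompletelyPositive_iff_posSemidef_choi.mp
      (hQ.1.comp (isCompletelyPositive_attach (Matrix.nonneg_iff_posSemidef.mp hS)))
  have h := re_trace_mul_sub_le hH hH' (hpsd (CFC.posPart_nonneg R)) (hpsd (CFC.negPart_nonneg R))
  rwa [← choi_sub, ← LinearMap.comp_sub, ← attach_sub, CFC.posPart_sub_negPart R hR,
    trace_choi_comp_attach hQ.2, trace_choi_comp_attach hQ.2, ← Complex.ofReal_natCast,
    Complex.re_ofReal_mul, Complex.re_ofReal_mul, ← mul_add,
    ← traceNorm_eq_posPart_add_negPart hR] at h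

/-- Partial transposition on all of Bob's systems moves the fidelity between the Choi states of
`N` and of the simulation to one between `N` conjugated by `T_B` and a channel acting on
`ρ^{T_B}`. -/
theorem one_sub_traceNorm_partialTranspose_div_le [Nonempty A] [Nonempty B]
    {N : SuperOp (A × B) (A' × B')} (hN : IsChannel N) (hproj : IsStarProjection (choiState N))
    (hpt : -1 ≤ choi (ptConj N)) (hpt' : choi (ptConj N) ≤ 1)
    {P : SuperOp ((A × Ah) × (B × Bh)) (A' × B')} (hP : IsCPPTP P) {ρ : Op (Ah × Bh)}
    (hρ : IsState ρ) :
    1 - traceNorm (partialTranspose Ah Bh ρ) / Fintype.card (A × B)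
      ≤ 1 / 2 * diamondDist N (simulation P ρ) := by
  have hsim : IsChannel (simulation P ρ) := hP.1.comp (isChannel_attach hρ)
  refine le_trans ?_ (one_sub_re_trace_choiState_mul_le hN hsim hproj)
  set K : ℝ := (Fintype.card (A × B) : ℝ)
  have hK : 0 < K := Nat.cast_pos.mpr Fintype.card_pos
  have hfid : (choiState N * choiState (simulation P ρ)).trace.re =
      K⁻¹ * K⁻¹ * (choi (ptConj N) *
        choi (ptConj P ∘ₗ attach (partialTranspose Ah Bh ρ))).trace.re := by
    rw [← ptConj_attach, ← ptConj_comp, trace_choi_ptConj_mul_choi_ptConj, choiState, choiState,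
      smul_mul_smul_comm, Matrix.trace_smul, smul_eq_mul, ← Complex.ofReal_natCast,
      ← Complex.ofReal_inv, ← Complex.ofReal_mul, Complex.re_ofReal_mul, simulation]
  have hbound := re_trace_mul_choi_comp_attach_le ⟨hP.2, hP.1.2.ptConj⟩
    (partialTranspose_isHermitian hρ.1.isHermitian) hpt hpt'
  have : K⁻¹ * K⁻¹ * (K * traceNorm (partialTranspose Ah Bh ρ)) =
      traceNorm (partialTranspose Ah Bh ρ) / K := by field_simp
  rw [hfid, ← this]
  gcongr
  exact hbound

theorem one_sub_traceNorm_partialTranspose_div_le_errorPPT [Nonempty A] [Nonempty B]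
    {N : SuperOp (A × B) (A' × B')} (hN : IsChannel N) (hproj : IsStarProjection (choiState N))
    (hpt : -1 ≤ choi (ptConj N)) (hpt' : choi (ptConj N) ≤ 1)
    {P : SuperOp ((A × Ah) × (B × Bh)) (A' × B')} (hP : IsCPPTP P) {ρ : Op (Ah × Bh)}
    (hρ : IsState ρ) :
    1 - traceNorm (partialTranspose Ah Bh ρ) / Fintype.card (A × B) ≤ errorPPT N ρ := by
  have : Nonempty {P : SuperOp ((A × Ah) × (B × Bh)) (A' × B') // IsCPPTP P} := ⟨⟨P, hP⟩⟩
  exact le_ciInf fun Q => one_sub_traceNorm_partialTranspose_div_le hN hproj hpt hpt' Q.2 hρ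

end Negativity

/-! ### The swap channel -/

section Swap

section Involution

variable {n : Type} [DecidableEq n] {σ : Equiv.Perm n}

theorem isHermitian_permMatrix (hσ : Function.Involutive σ) : (σ.permMatrix ℂ).IsHermitian := by
  rw [Matrix.IsHermitian, Matrix.conjTranspose_permMatrix, inv_eq_of_mul_eq_one_right]
  exact Equiv.ext hσ

theorem permMatrix_mul_self [Fintype n] (hσ : Function.Involutive σ) :
    σ.permMatrix ℂ * σ.permMatrix ℂ = 1 := by
  rw [← Matrix.permMatrix_mul, (Equiv.ext hσ : σ * σ = 1), Matrix.permMatrix_one]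

end Involution

variable {d : ℕ}

theorem swapOp_eq_permMatrix :
    swapOp d = Equiv.Perm.permMatrix ℂ (Equiv.prodComm (Fin d) (Fin d)) := by
  ext ⟨a, b⟩ ⟨a', b'⟩
  simp [swapOp, Matrix.sum_apply, Matrix.single_apply, Equiv.Perm.permMatrix,
    PEquiv.toMatrix_apply, ite_and]

theorem isHermitian_swapOp : (swapOp d).IsHermitian :=
  swapOp_eq_permMatrix ▸ isHermitian_permMatrix fun _ => rfl

theorem swapOp_mul_self : swapOp d * swapOp d = 1 := by
  rw [swapOp_eq_permMatrix, permMatrix_mul_self fun _ => rfl]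

theorem swapChannel_apply (X : Op (Fin d × Fin d)) :
    swapChannel d X = X.submatrix Prod.swap Prod.swap := by
  change swapOp d * X * (swapOp d)ᴴ = _
  rw [isHermitian_swapOp.eq, swapOp_eq_permMatrix, Equiv.Perm.permMatrix,
    PEquiv.toMatrix_toPEquiv_mul, PEquiv.mul_toMatrix_toPEquiv, Matrix.submatrix_submatrix]
  rfl

theorem isChannel_swapChannel : IsChannel (swapChannel d) := by
  refine ⟨fun n X hX => ?_, fun X => ?_⟩
  · convert hX.submatrix (Prod.map id Prod.swap) using 1
    ext r s
    simp only [idTensor, swapChannel_apply, LinearMap.coe_mk, AddHom.coe_mk, Matrix.of_apply,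
      Matrix.submatrix_apply, Prod.map, id_eq]
  · rw [swapChannel_apply]
    exact trace_submatrix_equiv (Equiv.prodComm _ _) X

theorem isStarProjection_choiState_swapChannel : IsStarProjection (choiState (swapChannel d)) := by
  convert isStarProjection_submatrix isStarProjection_maxEntangled
    ((Equiv.refl _).prodCongr (Equiv.prodComm (Fin d) (Fin d))) using 1
  ext r s
  rw [choiState, Matrix.smul_apply, choi_apply, swapChannel_apply]
  rfl

/-- The permutation that exchanges `A` with `B'` and `B` with `A'`. Its matrix is the partial
transpose of the Choi matrix of the swap channel `AB → A'B'`. -/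
def crossSwap (d : ℕ) : Equiv.Perm ((Fin d × Fin d) × (Fin d × Fin d)) :=
  Function.Involutive.toPerm (fun r => (r.2.swap, r.1.swap)) fun _ => rfl

theorem crossSwap_involutive : Function.Involutive (crossSwap d) := fun _ => rfl

theorem choi_ptConj_swapChannel : choi (ptConj (swapChannel d)) = (crossSwap d).permMatrix ℂ := by
  ext r s
  rw [choi_ptConj_apply, choi_apply, swapChannel_apply, Equiv.Perm.permMatrix,
    PEquiv.toMatrix_apply]
  simp only [Matrix.submatrix_apply, Matrix.single_apply, Equiv.toPEquiv_apply, crossSwap,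
    Option.mem_def, Option.some.injEq, Prod.ext_iff, Prod.fst_swap, Prod.snd_swap]
  exact if_congr (by tauto) rfl rfl

theorem neg_one_le_choi_ptConj_swapChannel : -1 ≤ choi (ptConj (swapChannel d)) := by
  rw [choi_ptConj_swapChannel]
  exact neg_one_le_of_mul_self_eq_one (isHermitian_permMatrix crossSwap_involutive)
    (permMatrix_mul_self crossSwap_involutive)

theorem choi_ptConj_swapChannel_le_one : choi (ptConj (swapChannel d)) ≤ 1 := by
  rw [choi_ptConj_swapChannel]
  exact le_one_of_mul_self_eq_one (isHermitian_permMatrix crossSwap_involutive)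
    (permMatrix_mul_self crossSwap_involutive)

end Swap

/-! ### Measuring and exchanging the outcomes -/

section Dephase

variable {C D : Type}

/-- Dephasing in the standard basis: it deletes all off-diagonal entries. -/
def dephase (D : Type) [DecidableEq D] : SuperOp D D where
  toFun X := Matrix.diagonal X.diag
  map_add' X Y := (Matrix.diagonal_add X.diag Y.diag).symm
  map_smul' c X := by rw [Matrix.diag_smul, Matrix.diagonal_smul]; rfl

theorem dephase_apply [DecidableEq D] (X : Op D) : dephase D X = Matrix.diagonal X.diag := rfl

variable [Fintype C] [Fintype D]

theorem isTracePreserving_dephase [DecidableEq D] : IsTracePreserving (dephase D) :=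
  fun X => Matrix.trace_diagonal X.diag

theorem isStarProjection_inv_card_smul_ones :
    IsStarProjection ((Fintype.card D : ℂ)⁻¹ • Matrix.vecMulVec (1 : D → ℂ) (1 : D → ℂ)) where
  isIdempotentElem := by
    rw [IsIdempotentElem, smul_mul_smul_comm, Matrix.vecMulVec_mul_vecMulVec,
      one_dotProduct_one, Matrix.vecMulVec_smul, smul_smul, mul_right_comm]
    congr 1
    simpa only [inv_inv] using mul_inv_mul_cancel (Fintype.card D : ℂ)⁻¹
  isSelfAdjoint := by
    have hones : IsSelfAdjoint (Matrix.vecMulVec (1 : D → ℂ) (star (1 : D → ℂ))) :=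
      (Matrix.posSemidef_vecMulVec_self_star 1).isHermitian
    rw [star_one] at hones
    exact ((IsSelfAdjoint.natCast _).inv₀).smul hones

theorem isCompletelyPositive_dephase_sub [DecidableEq D] :
    IsCompletelyPositive (dephase D - (Fintype.card D : ℂ)⁻¹ • LinearMap.id) := by
  refine isCompletelyPositive_of_hadamard
    (Matrix.nonneg_iff_posSemidef.mp isStarProjection_inv_card_smul_ones.one_sub.nonneg) fun X => ?_
  ext a b
  obtain rfl | h := eq_or_ne a b
  · simp [dephase_apply, mul_sub, mul_comm]
  · simp [dephase_apply, h, mul_comm]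

theorem half_diamondDist_dephase_comp_le [DecidableEq D] {N : SuperOp C D} (hN : IsChannel N) :
    1 / 2 * diamondDist N (dephase D ∘ₗ N) ≤ 1 - (Fintype.card D : ℝ)⁻¹ := by
  have hcp : IsCompletelyPositive
      (dephase D ∘ₗ N - (((Fintype.card D : ℝ)⁻¹ : ℝ) : ℂ) • N) := by
    rw [Complex.ofReal_inv, Complex.ofReal_natCast]
    exact isCompletelyPositive_dephase_sub.comp hN.1
  have h := diamondDist_le_of_isCompletelyPositive_sub hN (isTracePreserving_dephase.comp hN.2)
    (Nat.cast_inv_le_one _) hcp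
  linarith

end Dephase

section MeasurePrepare

variable {A B C Ah Bh : Type} [Fintype A] [Fintype Ah]

/-- Measuring the diagonal effect `g` and preparing `Y`: `X ↦ Tr(diag(g) X) Y`. -/
def measurePrepare (g : A → ℂ) (Y : Op C) : SuperOp A C where
  toFun X := (g ⬝ᵥ X.diag) • Y
  map_add' X X' := by rw [Matrix.diag_add, dotProduct_add, add_smul]
  map_smul' c X := by rw [Matrix.diag_smul, dotProduct_smul, smul_assoc]; rfl

theorem measurePrepare_apply (g : A → ℂ) (Y : Op C) (X : Op A) :
    measurePrepare g Y X = (g ⬝ᵥ X.diag) • Y := rfl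

open scoped Kronecker in
theorem choi_measurePrepare [DecidableEq A] (g : A → ℂ) (Y : Op C) :
    choi (measurePrepare g Y) = Matrix.diagonal g ⊗ₖ Y := by
  ext ⟨a, c⟩ ⟨a', c'⟩
  rw [choi_apply, measurePrepare_apply, Matrix.smul_apply, Matrix.kronecker_apply, smul_eq_mul]
  congr 1
  by_cases h : a = a'
  · subst h
    rw [Matrix.diag_single_same, dotProduct_single_one, Matrix.diagonal_apply_eq]
  · rw [Matrix.diag_single_of_ne _ _ _ h, dotProduct_zero, Matrix.diagonal_apply_ne _ h]

theorem isInstrument_measurePrepare [Fintype C] {ι : Type} [Fintype ι] {g : ι → A → ℂ}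
    (hg : ∀ i, 0 ≤ g i) (hg1 : ∑ i, g i = 1) {Y : Op C} (hY : IsState Y) :
    IsInstrument fun i => measurePrepare (g i) Y := by
  classical
  refine ⟨fun i => isCompletelyPositive_iff_posSemidef_choi.mpr ?_, fun X => ?_⟩
  · rw [choi_measurePrepare]
    exact (Matrix.PosSemidef.diagonal (hg i)).kronecker hY.1
  · simp only [LinearMap.sum_apply, measurePrepare_apply]
    rw [← Finset.sum_smul, ← sum_dotProduct, hg1, one_dotProduct, Matrix.trace_smul, hY.2,
      smul_eq_mul, mul_one]
    rfl

variable [DecidableEq A] [DecidableEq B]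

/-- Preparing `Y` upon finding the first of two systems in the basis state `i`. -/
def measureFst (Ah : Type) [Fintype Ah] (i : A) (Y : Op C) : SuperOp (A × Ah) C :=
  measurePrepare (fun a => if a.1 = i then 1 else 0) Y

theorem measureFst_apply (i : A) (Y : Op C) (X : Op (A × Ah)) :
    measureFst Ah i Y X = (∑ x, X (i, x) (i, x)) • Y := by
  rw [measureFst, measurePrepare_apply, dotProduct, Fintype.sum_prod_type,
    Finset.sum_eq_single_of_mem i (Finset.mem_univ i) fun b _ hb => by
      simp only [if_neg hb, zero_mul, Finset.sum_const_zero]]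
  simp only [if_true, one_mul, Matrix.diag_apply]

theorem isInstrument_measureFst [Fintype C] {Y : Op C} (hY : IsState Y) :
    IsInstrument fun i : A => measureFst Ah i Y := by
  refine isInstrument_measurePrepare (fun i a => ?_) (funext fun a => ?_) hY
  · dsimp only [Pi.zero_apply]
    split_ifs
    exacts [zero_le_one, le_rfl]
  · rw [Finset.sum_apply, Finset.sum_ite_eq, if_pos (Finset.mem_univ _), Pi.one_apply]

variable (A B Ah Bh) [Fintype B] [Fintype Bh]

/-- Both parties measure in the standard basis, announce the outcomes, and prepare the basis
state that the other one has found. Alice discards her systems after her measurement, so Bob's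
instrument acts next to the trivial system `Unit`. -/
def exchangeProtocol : SuperOp ((A × Ah) × (B × Bh)) (B × A) :=
  ∑ i : A, (∑ j : B, (∑ _k : Unit, LinearMap.id ∘ₗ
      tensorId A (measurePrepare (1 : Unit → ℂ) (Matrix.single j j 1))) ∘ₗ
    idTensor Unit (measureFst Bh j (Matrix.single i i 1))) ∘ₗ
  tensorId (B × Bh) (measureFst Ah i (1 : Op Unit))

theorem isLOCC_exchangeProtocol : IsLOCC (exchangeProtocol A B Ah Bh) := by
  have hUnit : IsState (1 : Op Unit) := ⟨Matrix.PosSemidef.one, by simp⟩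
  refine IsLOCC.alice _ _ (isInstrument_measureFst hUnit) fun i => ?_
  refine IsLOCC.bob _ _ (isInstrument_measureFst (isState_single i)) fun j => ?_
  refine IsLOCC.alice _ _ (isInstrument_measurePrepare (fun _ => zero_le_one) ?_
    (isState_single j)) fun _ => IsLOCC.done
  simp

theorem exchangeProtocol_apply (X : Op ((A × Ah) × (B × Bh))) :
    exchangeProtocol A B Ah Bh X = Matrix.diagonal fun r =>
      ∑ y, ∑ x, X ((r.2, x), (r.1, y)) ((r.2, x), (r.1, y)) := by
  ext ⟨b, a⟩ ⟨b', a'⟩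
  simp only [exchangeProtocol, LinearMap.sum_apply, LinearMap.comp_apply, Matrix.sum_apply,
    LinearMap.id_apply, Finset.univ_unique, Finset.sum_singleton]
  simp [tensorId, idTensor, measureFst_apply, measurePrepare_apply, Matrix.single_apply,
    Matrix.diagonal_apply, dotProduct, ite_and]

end MeasurePrepare

theorem simulation_exchangeProtocol {A B Ah Bh : Type} [Fintype A] [DecidableEq A] [Fintype B]
    [DecidableEq B] [Fintype Ah] [Fintype Bh] {ρ : Op (Ah × Bh)} (hρ : ρ.trace = 1)
    (X : Op (A × B)) :
    simulation (exchangeProtocol A B Ah Bh) ρ X =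
      Matrix.diagonal (X.submatrix Prod.swap Prod.swap).diag := by
  rw [simulation, LinearMap.comp_apply, exchangeProtocol_apply]
  congr 1
  funext r
  change ∑ y, ∑ x, X (r.2, r.1) (r.2, r.1) * ρ (x, y) (x, y) = X (r.2, r.1) (r.2, r.1)
  simp_rw [← Finset.mul_sum]
  rw [← Fintype.sum_prod_type_right' fun x y => ρ (x, y) (x, y)]
  exact (congrArg _ hρ).trans (mul_one _)

section SwapChannel

variable {Ah Bh : Type} [Fintype Ah] [Fintype Bh] {ρ : Op (Ah × Bh)}

theorem simulation_exchangeProtocol_eq_dephase_comp_swapChannel (d : ℕ) (hρ : ρ.trace = 1) :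
    simulation (exchangeProtocol (Fin d) (Fin d) Ah Bh) ρ =
      dephase (Fin d × Fin d) ∘ₗ swapChannel d :=
  LinearMap.ext fun X => by
    rw [simulation_exchangeProtocol hρ, LinearMap.comp_apply, swapChannel_apply, dephase_apply]

theorem errorLOCC_swapChannel_le (d : ℕ) (hρ : ρ.trace = 1) :
    errorLOCC (swapChannel d) ρ ≤ 1 - 1 / (d : ℝ) ^ 2 := by
  refine (errorLOCC_le (swapChannel d) ρ (isLOCC_exchangeProtocol _ _ Ah Bh)).trans ?_
  rw [simulation_exchangeProtocol_eq_dephase_comp_swapChannel d hρ]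
  refine (half_diamondDist_dephase_comp_le isChannel_swapChannel).trans_eq ?_
  rw [Fintype.card_prod, Fintype.card_fin, Nat.cast_mul, one_div, sq]

theorem errorPPT_swapChannel_le_errorLOCC (d : ℕ) (ρ : Op (Ah × Bh)) :
    errorPPT (swapChannel d) ρ ≤ errorLOCC (swapChannel d) ρ :=
  errorPPT_le_errorLOCC _ ρ (isLOCC_exchangeProtocol _ _ Ah Bh)

variable {d : ℕ}

theorem one_sub_traceNorm_partialTranspose_div_le_errorPPT_swapChannel [DecidableEq Ah]
    [DecidableEq Bh] (hd : 0 < d) (hρ : IsState ρ) :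
    1 - traceNorm (partialTranspose Ah Bh ρ) / (d : ℝ) ^ 2 ≤ errorPPT (swapChannel d) ρ := by
  have : NeZero d := ⟨hd.ne'⟩
  have h := one_sub_traceNorm_partialTranspose_div_le_errorPPT (isChannel_swapChannel (d := d))
    isStarProjection_choiState_swapChannel neg_one_le_choi_ptConj_swapChannel
    choi_ptConj_swapChannel_le_one (isLOCC_exchangeProtocol _ _ Ah Bh).isCPPTP hρ
  rwa [Fintype.card_prod, Fintype.card_fin, Nat.cast_mul, ← sq] at h

theorem errorPPT_swapChannel_of_posSemidef_partialTranspose (hd : 0 < d) (hρ : IsState ρ)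
    (hpt : (partialTranspose Ah Bh ρ).PosSemidef) :
    errorPPT (swapChannel d) ρ = 1 - 1 / (d : ℝ) ^ 2 := by
  classical
  refine le_antisymm
    ((errorPPT_swapChannel_le_errorLOCC d ρ).trans (errorLOCC_swapChannel_le d hρ.2)) ?_
  have h := one_sub_traceNorm_partialTranspose_div_le_errorPPT_swapChannel hd hρ
  rwa [traceNorm_of_posSemidef hpt, trace_partialTranspose, hρ.2, Complex.one_re] at h

theorem errorLOCC_swapChannel_of_posSemidef_partialTranspose (hd : 0 < d) (hρ : IsState ρ)
    (hpt : (partialTranspose Ah Bh ρ).PosSemidef) :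
    errorLOCC (swapChannel d) ρ = 1 - 1 / (d : ℝ) ^ 2 :=
  le_antisymm (errorLOCC_swapChannel_le d hρ.2)
    ((errorPPT_swapChannel_of_posSemidef_partialTranspose hd hρ hpt).ge.trans
      (errorPPT_swapChannel_le_errorLOCC d ρ))

end SwapChannel

/-! ### The Werner state -/

section Werner

variable {D : ℕ} {p : ℝ}

theorem trace_swapOp : (swapOp D).trace = D := by
  simp [swapOp, Matrix.trace, Matrix.sum_apply, Matrix.single_apply, ite_and,
    Fintype.sum_prod_type]

theorem partialTranspose_swapOp :
    partialTranspose (Fin D) (Fin D) (swapOp D) = (D : ℂ) • maxEntangled (Fin D) := by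
  obtain rfl | hD := eq_or_ne D 0
  · exact Subsingleton.elim _ _
  have hD' : (D : ℂ) ≠ 0 := Nat.cast_ne_zero.mpr hD
  rw [maxEntangled, choiState, Fintype.card_fin, smul_smul, mul_inv_cancel₀ hD', one_smul]
  ext r s
  rw [partialTranspose_apply, swapOp_eq_permMatrix, Equiv.Perm.permMatrix, PEquiv.toMatrix_apply,
    choi_id_apply]
  simp [and_comm, eq_comm (a := s.1)]

theorem isStarProjection_symProj : IsStarProjection (symProj D) :=
  isStarProjection_half_one_add isHermitian_swapOp swapOp_mul_self

theorem isStarProjection_antisymProj : IsStarProjection (antisymProj D) := by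
  rw [antisymProj, sub_eq_add_neg]
  exact isStarProjection_half_one_add isHermitian_swapOp.neg (by rw [neg_mul_neg, swapOp_mul_self])

theorem wernerState_eq (p : ℝ) (hD : 2 ≤ D) : wernerState p D =
    (((D - 1 + 2 * p) / (D * (D ^ 2 - 1)) : ℝ) : ℂ) • (1 : Op (Fin D × Fin D)) +
      ((((1 - 2 * p) * D - 1) / (D * (D ^ 2 - 1)) : ℝ) : ℂ) • swapOp D := by
  have h0 : (D : ℂ) ≠ 0 := Nat.cast_ne_zero.mpr (by omega)
  have h1 : (D : ℂ) - 1 ≠ 0 := sub_ne_zero.mpr (Nat.cast_ne_one.mpr (by omega))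
  have h2 : (D : ℂ) + 1 ≠ 0 := Nat.cast_add_one_ne_zero D
  have h3 : (D : ℂ) ^ 2 - 1 = (D - 1) * (D + 1) := by ring
  simp only [wernerState, symProj, antisymProj]
  push_cast
  rw [h3]
  match_scalars <;> (field_simp; ring)

theorem posSemidef_wernerState (hD : 1 ≤ D) (hp0 : 0 ≤ p) (hp1 : p ≤ 1) :
    (wernerState p D).PosSemidef := by
  have hD' : (1 : ℝ) ≤ D := Nat.one_le_cast.mpr hD
  have hsym : (0 : ℝ) ≤ (1 - p) * (2 / (D * (D + 1))) :=
    mul_nonneg (sub_nonneg.mpr hp1) (by positivity)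
  have hanti : (0 : ℝ) ≤ p * (2 / (D * (D - 1))) :=
    mul_nonneg hp0 (div_nonneg zero_le_two (mul_nonneg (by positivity) (sub_nonneg.mpr hD')))
  have hS := isStarProjection_symProj (D := D)
  have h := (posSemidef_ofReal_smul_of_isStarProjection hS hsym).add
    (posSemidef_ofReal_smul_of_isStarProjection isStarProjection_antisymProj hanti)
  push_cast at h
  exact h

theorem trace_wernerState (p : ℝ) (hD : 2 ≤ D) : (wernerState p D).trace = 1 := by
  have h0 : (D : ℂ) ≠ 0 := Nat.cast_ne_zero.mpr (by omega)
  have h1 : (D : ℂ) ^ 2 - 1 ≠ 0 := by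
    rw [sub_ne_zero]
    exact_mod_cast (by nlinarith : D ^ 2 ≠ 1)
  rw [wernerState_eq p hD, Matrix.trace_add, Matrix.trace_smul, Matrix.trace_smul, trace_swapOp,
    Matrix.trace_one, Fintype.card_prod, Fintype.card_fin]
  push_cast
  simp only [smul_eq_mul]
  field_simp
  ring

theorem isState_wernerState (hD : 2 ≤ D) (hp0 : 0 ≤ p) (hp1 : p ≤ 1) :
    IsState (wernerState p D) :=
  ⟨posSemidef_wernerState (by omega) hp0 hp1, trace_wernerState p hD⟩

theorem partialTranspose_wernerState (p : ℝ) (hD : 2 ≤ D) :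
    partialTranspose (Fin D) (Fin D) (wernerState p D) =
      (((D - 1 + 2 * p) / (D * (D ^ 2 - 1)) : ℝ) : ℂ) • (1 - maxEntangled (Fin D)) +
        (((1 - 2 * p) / D : ℝ) : ℂ) • maxEntangled (Fin D) := by
  have h0 : (D : ℂ) ≠ 0 := Nat.cast_ne_zero.mpr (by omega)
  have h1 : (D : ℂ) ^ 2 - 1 ≠ 0 := by
    rw [sub_ne_zero]
    exact_mod_cast (by nlinarith : D ^ 2 ≠ 1)
  rw [wernerState_eq p hD, map_add, map_smul, map_smul, partialTranspose_one,
    partialTranspose_swapOp]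
  push_cast
  match_scalars <;> field_simp
  ring

theorem posSemidef_partialTranspose_wernerState (hD : 2 ≤ D) (hp0 : 0 ≤ p) (hp : p ≤ 1 / 2) :
    (partialTranspose (Fin D) (Fin D) (wernerState p D)).PosSemidef := by
  have hD' : (2 : ℝ) ≤ D := Nat.ofNat_le_cast.mpr hD
  rw [partialTranspose_wernerState p hD]
  exact (posSemidef_ofReal_smul_of_isStarProjection isStarProjection_maxEntangled.one_sub
    (div_nonneg (by linarith) (mul_nonneg (by linarith) (by nlinarith)))).add
    (posSemidef_ofReal_smul_of_isStarProjection isStarProjection_maxEntangled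
      (div_nonneg (by linarith) (by linarith)))

theorem traceNorm_partialTranspose_wernerState_le (hD : 2 ≤ D) (hp : 1 / 2 ≤ p) :
    traceNorm (partialTranspose (Fin D) (Fin D) (wernerState p D)) ≤ (4 * p - 2 + D) / D := by
  have hD' : (2 : ℝ) ≤ D := Nat.ofNat_le_cast.mpr hD
  have hD0 : (D : ℝ) ≠ 0 := by linarith
  have hD1 : (D : ℝ) ^ 2 - 1 ≠ 0 := by nlinarith
  have : NeZero D := ⟨by omega⟩
  have hΦ := isStarProjection_maxEntangled (A := Fin D)
  have h := traceNorm_sub_le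
    (posSemidef_ofReal_smul_of_isStarProjection hΦ.one_sub
      (c := (D - 1 + 2 * p) / (D * (D ^ 2 - 1)))
      (div_nonneg (by linarith) (mul_nonneg (by linarith) (by nlinarith))))
    (posSemidef_ofReal_smul_of_isStarProjection hΦ (c := (2 * p - 1) / D)
      (div_nonneg (by linarith) (by linarith)))
  have hneg : (1 - 2 * p) / D = -((2 * p - 1) / D) := by ring
  rw [partialTranspose_wernerState p hD, hneg, Complex.ofReal_neg, neg_smul, ← sub_eq_add_neg]
  refine h.trans_eq ?_
  simp only [Matrix.trace_smul, Matrix.trace_sub, isState_maxEntangled.2, Matrix.trace_one,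
    smul_eq_mul, mul_one, Complex.re_ofReal_mul, Fintype.card_prod, Fintype.card_fin,
    Complex.ofReal_re, Complex.sub_re, Complex.one_re, Complex.natCast_re]
  push_cast
  field_simp
  ring

end Werner

/-! ### An optimal completely PPT preserving protocol -/

section Complement

variable {A B A' B' : Type} [Fintype A] [DecidableEq B]

/-- The completely depolarizing map without its normalization, `X ↦ (Tr X) I`. -/
def traceOne (A B : Type) [Fintype A] [DecidableEq B] : SuperOp A B where
  toFun X := X.trace • (1 : Op B)
  map_add' X Y := by rw [Matrix.trace_add, add_smul]
  map_smul' c X := by rw [Matrix.trace_smul, smul_assoc]; rfl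

theorem traceOne_apply (X : Op A) : traceOne A B X = X.trace • 1 := rfl

theorem choi_traceOne [DecidableEq A] : choi (traceOne A B) = 1 := by
  ext ⟨a, b⟩ ⟨a', b'⟩
  rw [choi_apply, traceOne_apply]
  obtain rfl | h := eq_or_ne a a'
  · simp [Matrix.one_apply]
  · simp [Matrix.trace_single_eq_of_ne _ _ _ h, h]

omit [DecidableEq B] in
theorem ptConj_traceOne [Fintype B] [DecidableEq A'] [DecidableEq B'] :
    ptConj (traceOne (A × B) (A' × B')) = traceOne (A × B) (A' × B') := by
  ext1 X
  change partialTranspose A' B' ((partialTranspose A B X).trace • 1) = X.trace • 1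
  rw [map_smul, partialTranspose_one, trace_partialTranspose]

variable [Fintype B]

/-- The channel whose Choi state is proportional to `1 - choiState N`, for a channel `N` whose
Choi state is a projection. -/
def complementChannel (N : SuperOp A B) : SuperOp A B :=
  (((Fintype.card A * Fintype.card B - 1)⁻¹ : ℝ) : ℂ) •
    ((Fintype.card A : ℂ) • traceOne A B - N)

theorem isCompletelyPositive_card_smul_traceOne_sub [DecidableEq A] [Nonempty A] {N : SuperOp A B}
    (hN : IsStarProjection (choiState N)) :
    IsCompletelyPositive ((Fintype.card A : ℂ) • traceOne A B - N) := by
  have hA : (Fintype.card A : ℂ) ≠ 0 := Nat.cast_ne_zero.mpr Fintype.card_ne_zero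
  have h := posSemidef_ofReal_smul_of_isStarProjection hN.one_sub
    (Nat.cast_nonneg (α := ℝ) (Fintype.card A))
  rw [isCompletelyPositive_iff_posSemidef_choi, choi_sub, choi_smul, choi_traceOne]
  rwa [choiState, Complex.ofReal_natCast, smul_sub, smul_smul, mul_inv_cancel₀ hA, one_smul] at h

theorem isChannel_complementChannel [DecidableEq A] {N : SuperOp A B} (hN : IsTracePreserving N)
    (hproj : IsStarProjection (choiState N)) (hcard : 1 < Fintype.card A * Fintype.card B) :
    IsChannel (complementChannel N) := by
  have : Nonempty A := Fintype.card_pos_iff.mp (Nat.pos_of_ne_zero fun h => by simp [h] at hcard)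
  have hcard' : (0 : ℝ) < Fintype.card A * Fintype.card B - 1 :=
    sub_pos.mpr (mod_cast hcard)
  refine ⟨(isCompletelyPositive_card_smul_traceOne_sub hproj).smul (inv_nonneg.mpr hcard'.le),
    fun X => ?_⟩
  have hne : (Fintype.card A : ℂ) * Fintype.card B - 1 ≠ 0 := mod_cast hcard'.ne'
  rw [complementChannel, LinearMap.smul_apply, LinearMap.sub_apply, LinearMap.smul_apply,
    traceOne_apply, Matrix.trace_smul, Matrix.trace_sub, Matrix.trace_smul, Matrix.trace_smul,
    Matrix.trace_one, hN X]
  push_cast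
  simp only [smul_eq_mul]
  field_simp

end Complement

section MeasureEffect

variable {A B Ah Bh : Type} [Fintype Ah] [Fintype Bh]

/-- Measuring the effect `M` on the resource systems: `X ↦ Tr_{ÂB̂}(X (I ⊗ M))`. -/
def measureEffect (M : Op (Ah × Bh)) : SuperOp ((A × Ah) × (B × Bh)) (A × B) where
  toFun X := Matrix.of fun r s => ∑ x, ∑ y,
    X ((r.1, x.1), (r.2, x.2)) ((s.1, y.1), (s.2, y.2)) * M y x
  map_add' X Y := by
    ext r s
    simp [add_mul, Finset.sum_add_distrib]
  map_smul' c X := by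
    ext r s
    simp [mul_assoc, Finset.mul_sum]

theorem measureEffect_apply (M : Op (Ah × Bh)) (X : Op ((A × Ah) × (B × Bh))) (r s : A × B) :
    measureEffect M X r s = ∑ x, ∑ y,
      X ((r.1, x.1), (r.2, x.2)) ((s.1, y.1), (s.2, y.2)) * M y x := rfl

theorem measureEffect_add (M M' : Op (Ah × Bh)) :
    measureEffect (A := A) (B := B) (M + M') = measureEffect M + measureEffect M' := by
  ext X r s
  simp only [measureEffect_apply, LinearMap.add_apply, Matrix.add_apply, mul_add,
    Finset.sum_add_distrib]

theorem measureEffect_smul (c : ℂ) (M : Op (Ah × Bh)) :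
    measureEffect (A := A) (B := B) (c • M) = c • measureEffect M := by
  ext X r s
  simp only [measureEffect_apply, LinearMap.smul_apply, Matrix.smul_apply, smul_eq_mul,
    Finset.mul_sum, mul_left_comm]

theorem measureEffect_comp_attach (M ρ : Op (Ah × Bh)) :
    measureEffect (A := A) (B := B) M ∘ₗ attach ρ = (ρ * M).trace • LinearMap.id := by
  ext X r s
  change ∑ x, ∑ y, X r s * ρ x y * M y x = (ρ * M).trace * X r s
  simp only [Matrix.trace, Matrix.diag, Matrix.mul_apply, Finset.sum_mul]
  exact Finset.sum_congr rfl fun x _ => Finset.sum_congr rfl fun y _ => by ring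

theorem isCompletelyPositive_measureEffect [Finite A] [Finite B] {M : Op (Ah × Bh)}
    (hM : M.PosSemidef) : IsCompletelyPositive (measureEffect (A := A) (B := B) M) := by
  have := Fintype.ofFinite A
  have := Fintype.ofFinite B
  intro n X hX
  have h := posSemidef_blockSum
    ((hX.submatrix fun p : (Fin n × A × B) × (Ah × Bh) =>
        (p.1.1, (p.1.2.1, p.2.1), (p.1.2.2, p.2.2))).hadamard
      (hM.transpose.submatrix fun p : (Fin n × A × B) × (Ah × Bh) => p.2))
  convert h using 1
  ext r s
  rfl

theorem ptConj_measureEffect (M : Op (Ah × Bh)) :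
    ptConj (measureEffect (A := A) (B := B) M) = measureEffect (partialTranspose Ah Bh M) := by
  ext X r s
  change ∑ x : Ah × Bh, ∑ y : Ah × Bh,
      X ((r.1, x.1), (r.2, y.2)) ((s.1, y.1), (s.2, x.2)) * M y x
    = ∑ x : Ah × Bh, ∑ y : Ah × Bh,
      X ((r.1, x.1), (r.2, x.2)) ((s.1, y.1), (s.2, y.2)) * M (y.1, x.2) (x.1, y.2)
  rw [← Fintype.sum_prod_type', ← Fintype.sum_prod_type']
  exact Fintype.sum_equiv
    { toFun := fun z => ((z.1.1, z.2.2), (z.2.1, z.1.2))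
      invFun := fun z => ((z.1.1, z.2.2), (z.2.1, z.1.2))
      left_inv := fun _ => rfl
      right_inv := fun _ => rfl } _ _ fun _ => rfl

variable [Fintype A] [Fintype B] [DecidableEq Ah] [DecidableEq Bh]

theorem isTracePreserving_measureEffect_one :
    IsTracePreserving (measureEffect (A := A) (B := B) (1 : Op (Ah × Bh))) := by
  intro X
  simp only [Matrix.trace, Matrix.diag, measureEffect_apply, Matrix.one_apply, mul_ite, mul_one,
    mul_zero, Finset.sum_ite_eq', Finset.mem_univ, if_true]
  rw [← Fintype.sum_prod_type']
  exact Fintype.sum_equiv (Equiv.prodProdProdComm A B Ah Bh) _ _ fun _ => rfl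

/-- The map that applies `N` or `K` according to whether the effect `M` is found on the resource
systems or not. -/
def conditional {C : Type} (N K : SuperOp (A × B) C) (M : Op (Ah × Bh)) :
    SuperOp ((A × Ah) × (B × Bh)) C :=
  N ∘ₗ measureEffect M + K ∘ₗ measureEffect (1 - M)

variable {A' B' : Type} [Fintype A'] [Fintype B'] {N K : SuperOp (A × B) (A' × B')}
  {M : Op (Ah × Bh)}

theorem isChannel_conditional (hN : IsChannel N) (hK : IsChannel K) (hM : 0 ≤ M) (hM' : M ≤ 1) :
    IsChannel (conditional N K M) := by
  refine ⟨(hN.1.comp (isCompletelyPositive_measureEffect (Matrix.nonneg_iff_posSemidef.mp hM))).add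
    (hK.1.comp (isCompletelyPositive_measureEffect (Matrix.le_iff.mp hM'))), fun X => ?_⟩
  rw [conditional, LinearMap.add_apply, Matrix.trace_add, LinearMap.comp_apply,
    LinearMap.comp_apply, hN.2, hK.2, ← Matrix.trace_add, ← LinearMap.add_apply,
    ← measureEffect_add, add_sub_cancel, isTracePreserving_measureEffect_one]

omit [Fintype A] [Fintype B] [Fintype A'] [Fintype B'] in
theorem simulation_conditional (N K : SuperOp (A × B) (A' × B')) (M ρ : Op (Ah × Bh)) :
    simulation (conditional N K M) ρ = (ρ * M).trace • N + (ρ * (1 - M)).trace • K := by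
  rw [simulation, conditional, LinearMap.add_comp, LinearMap.comp_assoc, LinearMap.comp_assoc,
    measureEffect_comp_attach, measureEffect_comp_attach, LinearMap.comp_smul,
    LinearMap.comp_smul, LinearMap.comp_id, LinearMap.comp_id]

theorem half_diamondDist_simulation_conditional_le [DecidableEq A'] [DecidableEq B']
    (hN : IsChannel N) (hK : IsChannel K) (hM : 0 ≤ M) (hM' : M ≤ 1)
    {ρ : Op (Ah × Bh)} (hρ : IsState ρ) {f : ℝ} (hf : (ρ * M).trace = f) :
    1 / 2 * diamondDist N (simulation (conditional N K M) ρ) ≤ 1 - f := by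
  have htr : (ρ * (1 - M)).trace = ((1 - f : ℝ) : ℂ) := by
    rw [mul_sub, mul_one, Matrix.trace_sub, hρ.2, hf, Complex.ofReal_sub, Complex.ofReal_one]
  have hf1 : 0 ≤ 1 - f := by
    have h := re_trace_mul_nonneg hρ.1 (Matrix.le_iff.mp hM')
    rwa [htr, Complex.ofReal_re] at h
  have hcp : IsCompletelyPositive (simulation (conditional N K M) ρ - (f : ℂ) • N) := by
    rw [simulation_conditional, htr, hf, add_sub_cancel_left]
    exact hK.1.smul hf1
  have h : diamondDist N (simulation (conditional N K M) ρ) ≤ 2 * (1 - f) :=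
    diamondDist_le_of_isCompletelyPositive_sub hN
      ((isChannel_conditional hN hK hM hM').comp (isChannel_attach hρ)).2 (sub_nonneg.mp hf1) hcp
  linarith

end MeasureEffect

section PPTProtocol

variable {d D : ℕ} {p : ℝ}

theorem isCompletelyPositive_traceOne_add_ptConj_swapChannel :
    IsCompletelyPositive (traceOne (Fin d × Fin d) (Fin d × Fin d) + ptConj (swapChannel d)) := by
  rw [isCompletelyPositive_iff_posSemidef_choi, choi_add, choi_traceOne, add_comm,
    ← sub_neg_eq_add]
  exact Matrix.le_iff.mp neg_one_le_choi_ptConj_swapChannel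

theorem isCompletelyPositive_traceOne_sub_ptConj_swapChannel :
    IsCompletelyPositive (traceOne (Fin d × Fin d) (Fin d × Fin d) - ptConj (swapChannel d)) := by
  rw [isCompletelyPositive_iff_posSemidef_choi, choi_sub, choi_traceOne]
  exact Matrix.le_iff.mp choi_ptConj_swapChannel_le_one

/-- The effect on the resource systems on which the optimal protocol applies the swap channel.
Both it and its complement have partial transposes in the span of `maxEntangled` and its
complement. -/
def swapEffect (d D : ℕ) : Op (Fin D × Fin D) :=
  ((1 / (d : ℝ) ^ 2 : ℝ) : ℂ) • (1 + ((-(2 / D) : ℝ) : ℂ) • swapOp D)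

theorem swapEffect_nonneg (hD : 2 ≤ D) : 0 ≤ swapEffect d D := by
  have hD' : (2 : ℝ) ≤ D := Nat.ofNat_le_cast.mpr hD
  refine smul_nonneg (Complex.zero_le_real.mpr (by positivity)) (one_add_smul_nonneg
    (neg_one_le_of_mul_self_eq_one isHermitian_swapOp swapOp_mul_self)
    (le_one_of_mul_self_eq_one isHermitian_swapOp swapOp_mul_self) ?_ ?_)
  · rw [neg_le_neg_iff, div_le_one (by linarith)]
    exact hD'
  · exact (neg_nonpos.mpr (by positivity)).trans zero_le_one

theorem one_sub_swapEffect (hd : 2 ≤ d) : 1 - swapEffect d D =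
    ((((d : ℝ) ^ 2 - 1) / (d : ℝ) ^ 2 : ℝ) : ℂ) •
      (1 + ((2 / (D * ((d : ℝ) ^ 2 - 1)) : ℝ) : ℂ) • swapOp D) := by
  have hd0 : (d : ℂ) ≠ 0 := Nat.cast_ne_zero.mpr (by omega)
  have hd1 : (d : ℂ) ^ 2 - 1 ≠ 0 := by
    rw [sub_ne_zero]
    exact_mod_cast (by nlinarith : d ^ 2 ≠ 1)
  rw [swapEffect]
  push_cast
  match_scalars <;> field_simp

theorem swapEffect_le_one (hd : 2 ≤ d) (hD : 2 ≤ D) : swapEffect d D ≤ 1 := by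
  have hd' : (2 : ℝ) ≤ d := Nat.ofNat_le_cast.mpr hd
  have hD' : (2 : ℝ) ≤ D := Nat.ofNat_le_cast.mpr hD
  have hd2 : (0 : ℝ) < (d : ℝ) ^ 2 - 1 := by nlinarith
  rw [← sub_nonneg, one_sub_swapEffect hd]
  refine smul_nonneg (Complex.zero_le_real.mpr (by positivity)) (one_add_smul_nonneg
    (neg_one_le_of_mul_self_eq_one isHermitian_swapOp swapOp_mul_self)
    (le_one_of_mul_self_eq_one isHermitian_swapOp swapOp_mul_self) ?_ ?_)
  · exact (neg_nonpos.mpr zero_le_one).trans (by positivity)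
  · rw [div_le_one (by positivity)]
    nlinarith

theorem trace_wernerState_mul_swapEffect (d : ℕ) (p : ℝ) (hD : 2 ≤ D) :
    (wernerState p D * swapEffect d D).trace =
      (((4 * p - 2 + D) / ((d : ℝ) ^ 2 * D) : ℝ) : ℂ) := by
  have hD0 : (D : ℂ) ≠ 0 := Nat.cast_ne_zero.mpr (by omega)
  have hD1 : (D : ℂ) ^ 2 - 1 ≠ 0 := by
    rw [sub_ne_zero]
    exact_mod_cast (by nlinarith : D ^ 2 ≠ 1)
  rw [wernerState_eq p hD, swapEffect]
  simp only [mul_smul_comm, mul_add, add_mul, smul_mul_assoc, swapOp_mul_self, mul_one, one_mul,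
    Matrix.trace_smul, Matrix.trace_add, trace_swapOp, Matrix.trace_one, smul_eq_mul,
    Fintype.card_prod, Fintype.card_fin]
  push_cast
  field_simp
  ring

theorem partialTranspose_swapEffect (d : ℕ) (hD : D ≠ 0) :
    partialTranspose (Fin D) (Fin D) (swapEffect d D) =
      (1 / (d : ℂ) ^ 2) • (1 - maxEntangled (Fin D)) +
        (-(1 / (d : ℂ) ^ 2)) • maxEntangled (Fin D) := by
  have hD0 : (D : ℂ) ≠ 0 := Nat.cast_ne_zero.mpr hD
  rw [swapEffect, map_smul, map_add, map_smul, partialTranspose_one, partialTranspose_swapOp]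
  push_cast
  match_scalars <;> field_simp
  ring

theorem partialTranspose_one_sub_swapEffect (hd : d ≠ 0) (hD : D ≠ 0) :
    partialTranspose (Fin D) (Fin D) (1 - swapEffect d D) =
      (((d : ℂ) ^ 2 - 1) / (d : ℂ) ^ 2) • (1 - maxEntangled (Fin D)) +
        (((d : ℂ) ^ 2 + 1) / (d : ℂ) ^ 2) • maxEntangled (Fin D) := by
  have hd0 : (d : ℂ) ≠ 0 := Nat.cast_ne_zero.mpr hd
  rw [map_sub, partialTranspose_swapEffect d hD, partialTranspose_one]
  match_scalars <;> field_simp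
  ring

/-- The optimal completely PPT preserving protocol: it applies the swap channel if `swapEffect` is
found on the resource systems and the complement of the swap channel otherwise. -/
def pptProtocol (d D : ℕ) : SuperOp ((Fin d × Fin D) × (Fin d × Fin D)) (Fin d × Fin d) :=
  conditional (swapChannel d) (complementChannel (swapChannel d)) (swapEffect d D)

theorem ptConj_pptProtocol (hd : 2 ≤ d) (hD : D ≠ 0) : ptConj (pptProtocol d D) =
    ((1 / ((d : ℝ) ^ 2 + 1) : ℝ) : ℂ) • ((traceOne _ _ + ptConj (swapChannel d)) ∘ₗ
        measureEffect (1 - maxEntangled (Fin D))) +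
      ((1 / ((d : ℝ) ^ 2 - 1) : ℝ) : ℂ) • ((traceOne _ _ - ptConj (swapChannel d)) ∘ₗ
        measureEffect (maxEntangled (Fin D))) := by
  have hd0 : (d : ℂ) ≠ 0 := Nat.cast_ne_zero.mpr (by omega)
  have hdm : (d : ℂ) ^ 2 - 1 ≠ 0 := by
    rw [sub_ne_zero]
    exact_mod_cast (by nlinarith : d ^ 2 ≠ 1)
  have hdp : (d : ℂ) ^ 2 + 1 ≠ 0 := by exact_mod_cast (d ^ 2).succ_ne_zero
  have hd4 : (d : ℂ) * d * (d * d) - 1 = (d ^ 2 - 1) * (d ^ 2 + 1) := by ring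
  rw [pptProtocol, conditional, complementChannel, ptConj_add, ptConj_comp, ptConj_comp,
    ptConj_smul, ptConj_sub, ptConj_smul, ptConj_traceOne, ptConj_measureEffect,
    ptConj_measureEffect, partialTranspose_swapEffect d hD,
    partialTranspose_one_sub_swapEffect (by omega) hD]
  simp only [measureEffect_add, measureEffect_smul, Fintype.card_prod, Fintype.card_fin]
  ext1 X
  simp only [LinearMap.add_apply, LinearMap.sub_apply, LinearMap.smul_apply, LinearMap.comp_apply,
    map_add, map_smul]
  push_cast
  rw [hd4]
  match_scalars <;> field_simp <;> ring

theorem isChannel_complementChannel_swapChannel (hd : 2 ≤ d) :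
    IsChannel (complementChannel (swapChannel d)) := by
  refine isChannel_complementChannel isChannel_swapChannel.2
    isStarProjection_choiState_swapChannel ?_
  rw [Fintype.card_prod, Fintype.card_fin]
  have hdd : 1 < d * d := Nat.one_lt_mul_iff.mpr (by omega)
  exact Nat.one_lt_mul_iff.mpr (by omega)

theorem isCPPTP_pptProtocol (hd : 2 ≤ d) (hD : 2 ≤ D) : IsCPPTP (pptProtocol d D) := by
  have : NeZero D := ⟨by omega⟩
  have hd' : (2 : ℝ) ≤ d := Nat.ofNat_le_cast.mpr hd
  have hΦ := isStarProjection_maxEntangled (A := Fin D)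
  have hcp : IsCompletelyPositive (ptConj (pptProtocol d D)) := by
    rw [ptConj_pptProtocol hd (by omega)]
    exact ((isCompletelyPositive_traceOne_add_ptConj_swapChannel.comp
        (isCompletelyPositive_measureEffect (Matrix.nonneg_iff_posSemidef.mp hΦ.one_sub.nonneg))
        ).smul (by positivity)).add
      ((isCompletelyPositive_traceOne_sub_ptConj_swapChannel.comp
        (isCompletelyPositive_measureEffect (Matrix.nonneg_iff_posSemidef.mp hΦ.nonneg))
        ).smul (one_div_nonneg.mpr (by nlinarith)))
  exact ⟨isChannel_conditional isChannel_swapChannel (isChannel_complementChannel_swapChannel hd)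
    (swapEffect_nonneg hD) (swapEffect_le_one hd hD), hcp⟩

theorem errorPPT_swapChannel_wernerState_le (hd : 2 ≤ d) (hD : 2 ≤ D) (hp0 : 0 ≤ p)
    (hp1 : p ≤ 1) : errorPPT (swapChannel d) (wernerState p D) ≤
      1 - (4 * p - 2 + D) / ((d : ℝ) ^ 2 * D) :=
  (errorPPT_le (swapChannel d) (wernerState p D) (isCPPTP_pptProtocol hd hD)).trans
    (half_diamondDist_simulation_conditional_le isChannel_swapChannel
      (isChannel_complementChannel_swapChannel hd) (swapEffect_nonneg hD)
      (swapEffect_le_one hd hD) (isState_wernerState hD hp0 hp1)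
      (trace_wernerState_mul_swapEffect d p hD))

theorem errorPPT_swapChannel_wernerState_of_half_le (hd : 2 ≤ d) (hD : 2 ≤ D)
    (hp : 1 / 2 ≤ p) (hp1 : p ≤ 1) : errorPPT (swapChannel d) (wernerState p D) =
      1 - (4 * p - 2 + D) / ((d : ℝ) ^ 2 * D) := by
  have hp0 : 0 ≤ p := by linarith
  refine (errorPPT_swapChannel_wernerState_le hd hD hp0 hp1).antisymm ?_
  calc 1 - (4 * p - 2 + D) / ((d : ℝ) ^ 2 * D)
      = 1 - (4 * p - 2 + D) / D / (d : ℝ) ^ 2 := by rw [div_div, mul_comm (D : ℝ)]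
    _ ≤ 1 - traceNorm (partialTranspose (Fin D) (Fin D) (wernerState p D)) / (d : ℝ) ^ 2 := by
        gcongr
        exact traceNorm_partialTranspose_wernerState_le hD hp
    _ ≤ errorPPT (swapChannel d) (wernerState p D) :=
        one_sub_traceNorm_partialTranspose_div_le_errorPPT_swapChannel (by omega)
          (isState_wernerState hD hp0 hp1)

end PPTProtocol

end

end BidirTeleport

theorem mainTheorem6 (d dA : ℕ) (hd : 2 ≤ d) (hdA : 2 ≤ dA) (p : ℝ) (hp0 : 0 ≤ p) (hp1 : p ≤ 1) :
    (p ≤ 1 / 2 →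
      BidirTeleport.errorPPT (BidirTeleport.swapChannel d) (BidirTeleport.wernerState p dA)
        = 1 - 1 / (d : ℝ) ^ 2) ∧
    (1 / 2 < p →
      BidirTeleport.errorPPT (BidirTeleport.swapChannel d) (BidirTeleport.wernerState p dA)
        = 1 - (4 * p - 2 + (dA : ℝ)) / ((d : ℝ) ^ 2 * (dA : ℝ))) ∧
    (p ≤ 1 / 2 →
      BidirTeleport.errorPPT (BidirTeleport.swapChannel d) (BidirTeleport.wernerState p dA)
        = BidirTeleport.errorLOCC (BidirTeleport.swapChannel d)
            (BidirTeleport.wernerState p dA)) := by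
  have hW := BidirTeleport.isState_wernerState hdA hp0 hp1
  have hPPT (hp : p ≤ 1 / 2) :=
    BidirTeleport.posSemidef_partialTranspose_wernerState hdA hp0 hp
  have hd0 : 0 < d := by omega
  refine ⟨fun hp => ?_, fun hp => ?_, fun hp => ?_⟩
  · exact BidirTeleport.errorPPT_swapChannel_of_posSemidef_partialTranspose hd0 hW (hPPT hp)
  · exact BidirTeleport.errorPPT_swapChannel_wernerState_of_half_le hd hdA hp.le hp1
  · rw [BidirTeleport.errorPPT_swapChannel_of_posSemidef_partialTranspose hd0 hW (hPPT hp),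
      BidirTeleport.errorLOCC_swapChannel_of_posSemidef_partialTranspose hd0 hW (hPPT hp)]
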